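/- Let $k$ be a field, let $H$ be a Hopf algebra over $k$ with bijective antipode $\mathcal S$, and let $R$ be a Hopf algebra in the braided monoidal category ${}^H_H\mathcal{YD}$ of left Yetter–Drinfeld modules over $H$, that is, of left $H$-modules and left $H$-comodules $V$ with $$\rho(h\cdot v)=h_{(1)}v_{(-1)}\mathcal S(h_{(3)})\otimes h_{(2)}\cdot v_{(0)}\qquad (h\in H,\ v\in V),$$ with braiding $c(v\otimes w)=v_{(-1)}\cdot w\otimes v_{(0)}$. Let $A=R\# H$ be the bosonization of $R$ by $H$: the Hopf algebra with underlying vector space $R\otimes H$, unit $1\otimes 1$, counit $\varepsilon\otimes\varepsilon$, and $$(r\otimes h)(s\otimes a)=r\,(h_{(1)}\cdot s)\otimes h_{(2)}a,\qquad \Delta(s\otimes h)=s^{(1)}\otimes (s^{(2)})_{(-1)}h_{(1)}\otimes (s^{(2)})_{(0)}\otimes h_{(2)},$$ where $s^{(1)}\otimes s^{(2)}$ denotes the coproduct of $s\in R$. For $C\in\{H,R,A\}$, a left (respectively right) integral on $C$ is a linear form $\lambda\in C^*$ with $\alpha*\lambda=\alpha(1)\lambda$ (respectively $\lambda*\alpha=\alpha(1)\lambda$)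 for all $\alpha\in C^*$, where $(\alpha*\beta)(c)=\alpha(c_1)\beta(c_2)$ and $c_1\otimes c_2$ is the coproduct of $c$ in $C$; and $C$ is called left (respectively right) co-Frobenius if it admits a nonzero left (respectively right) integral. Then $A$ is left co-Frobenius if and only if both $H$ and $R$ are left co-Frobenius, and $A$ is right co-Frobenius if and only if both $H$ and $R$ are right co-Frobenius. -/

import Mathlib

open scoped TensorProduct

noncomputable section

namespace BraidedHopf

set_option linter.unusedSimpArgs false
set_option linter.unusedSectionVars false

universe u v w x

/-- The linear map `V ⊗ W → B`, `v ⊗ w ↦ f v * g w`. -/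
def pair {k : Type*} [Field k] {V W B : Type*} [AddCommGroup V] [Module k V] [AddCommGroup W]
    [Module k W] [Semiring B] [Algebra k B] (f : V →ₗ[k] B) (g : W →ₗ[k] B) : V ⊗[k] W →ₗ[k] B :=
  LinearMap.mul' k B ∘ₗ TensorProduct.map f g

/-- A `k`-vector space `V` with an action of `H`, given as an algebra map `H → End V`, and a
linear map `V → H ⊗ V`, on which no law is imposed yet. -/
class YDStruct (k : Type u) (H : Type v) (V : Type w) [Field k] [Ring H] [HopfAlgebra k H]
    [AddCommGroup V] [Module k V] where
  /-- The left action of `H`. -/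
  act : H →ₐ[k] Module.End k V
  /-- The left coaction of `H`. -/
  coact : V →ₗ[k] H ⊗[k] V

section Def

variable (k : Type u) (H : Type v) [Field k] [Ring H] [HopfAlgebra k H]

open YDStruct

/-- The map `(a ⊗ b) ⊗ c ↦ (x ⊗ v ↦ a x S(c) ⊗ b · v)`. -/
def ydTwist (V : Type w) [AddCommGroup V] [Module k V] [YDStruct k H V] :
    (H ⊗[k] H) ⊗[k] H →ₗ[k] Module.End k (H ⊗[k] V) :=
  pair (B := Module.End k (H ⊗[k] V))
    ((Module.endTensorEndAlgHom (R := k) (S := k) (A := k) (M := H) (N := V)).comp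
      (Algebra.TensorProduct.map (Algebra.lmul k H) act)).toLinearMap
    (LinearMap.rTensorHom V ∘ₗ (LinearMap.mul k H).flip ∘ₗ HopfAlgebra.antipode k)

/-- Left Yetter–Drinfeld modules over `H`: left modules and left comodules `V` such that
`ρ(h · v) = h₁ v₋₁ S(h₃) ⊗ h₂ · v₀`. -/
class YetterDrinfeldModule (V : Type w) [AddCommGroup V] [Module k V]
    extends YDStruct k H V where
  coact_coassoc : TensorProduct.assoc k H H V ∘ₗ
    (Coalgebra.comul (R := k) (A := H)).rTensor V ∘ₗ coact = coact.lTensor H ∘ₗ coact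
  coact_counit : (Coalgebra.counit (R := k) (A := H)).rTensor V ∘ₗ coact =
    TensorProduct.mk k k V 1
  compat : ∀ (h : H) (v : V), coact (act h v) =
    ydTwist k H V ((Coalgebra.comul (R := k) (A := H)).rTensor H (Coalgebra.comul h)) (coact v)

/-- The unit object `k`: `h · c = ε(h) c` and `ρ(c) = 1 ⊗ c`. -/
instance instYDStructUnit : YDStruct k H k where
  act := (Algebra.ofId k (Module.End k k)).comp (Bialgebra.counitAlgHom k H)
  coact := TensorProduct.mk k H k 1

/-- The tensor product of two Yetter–Drinfeld modules: `h · (v ⊗ w) = h₁ · v ⊗ h₂ · w` and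
`ρ(v ⊗ w) = v₋₁ w₋₁ ⊗ (v₀ ⊗ w₀)`. -/
instance instYDStructTensor (V : Type w) (W : Type x) [AddCommGroup V] [Module k V]
    [AddCommGroup W] [Module k W] [YDStruct k H V] [YDStruct k H W] :
    YDStruct k H (V ⊗[k] W) where
  act := (Module.endTensorEndAlgHom (R := k) (S := k) (A := k) (M := V) (N := W)).comp
    ((Algebra.TensorProduct.map act act).comp (Bialgebra.comulAlgHom k H))
  coact := (LinearMap.mul' k H).rTensor (V ⊗[k] W) ∘ₗ
    (TensorProduct.tensorTensorTensorComm k H V H W).toLinearMap ∘ₗ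
    TensorProduct.map coact coact

/-- Morphisms of Yetter–Drinfeld modules: `H`-linear and `H`-colinear maps. -/
def IsYDHom {V : Type w} {W : Type x} [AddCommGroup V] [Module k V] [AddCommGroup W] [Module k W]
    [YDStruct k H V] [YDStruct k H W] (f : V →ₗ[k] W) : Prop :=
  (∀ (h : H) (v : V), f (act (k := k) h v) = act (k := k) h (f v)) ∧
    coact ∘ₗ f = f.lTensor H ∘ₗ coact

/-- The braiding `c(v ⊗ w) = v₋₁ · w ⊗ v₀`. -/
def braiding (V : Type w) (W : Type x) [AddCommGroup V] [Module k V] [AddCommGroup W]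
    [Module k W] [YDStruct k H V] [YDStruct k H W] : V ⊗[k] W →ₗ[k] W ⊗[k] V :=
  (TensorProduct.lift (act (k := k) (H := H) (V := W)).toLinearMap).rTensor V ∘ₗ
    (TensorProduct.assoc k H W V).symm.toLinearMap ∘ₗ
    (TensorProduct.comm k V W).toLinearMap.lTensor H ∘ₗ
    (TensorProduct.assoc k H V W).toLinearMap ∘ₗ
    (coact (k := k) (H := H) (V := V)).rTensor W

/-- The multiplication of the braided tensor product algebra `R ⊗ R`:
`(a ⊗ b)(c ⊗ d) = a (b₋₁ · c) ⊗ b₀ d`. -/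
def braidedMul (R : Type w) [Ring R] [Algebra k R] [YDStruct k H R] :
    (R ⊗[k] R) ⊗[k] (R ⊗[k] R) →ₗ[k] R ⊗[k] R :=
  TensorProduct.map (LinearMap.mul' k R) (LinearMap.mul' k R) ∘ₗ
    (TensorProduct.assoc k R R (R ⊗[k] R)).symm.toLinearMap ∘ₗ
    ((TensorProduct.assoc k R R R).toLinearMap ∘ₗ (braiding k H R R).rTensor R ∘ₗ
      (TensorProduct.assoc k R R R).symm.toLinearMap).lTensor R ∘ₗ
    (TensorProduct.assoc k R R (R ⊗[k] R)).toLinearMap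

/-- Hopf algebras in the braided category of left Yetter–Drinfeld modules over `H`. -/
class BraidedHopfAlgebra (R : Type w) [Ring R] [Algebra k R] [Coalgebra k R]
    extends YetterDrinfeldModule k H R where
  unit_hom : IsYDHom k H (Algebra.linearMap k R)
  mul_hom : IsYDHom k H (LinearMap.mul' k R)
  counit_hom : IsYDHom k H (Coalgebra.counit (R := k) (A := R))
  comul_hom : IsYDHom k H (Coalgebra.comul (R := k) (A := R))
  counit_one : Coalgebra.counit (R := k) (1 : R) = 1
  counit_mul : ∀ r s : R, Coalgebra.counit (R := k) (r * s) =
    Coalgebra.counit (R := k) r * Coalgebra.counit (R := k) s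
  comul_one : Coalgebra.comul (R := k) (1 : R) = 1 ⊗ₜ[k] 1
  comul_mul : ∀ r s : R, Coalgebra.comul (R := k) (r * s) =
    braidedMul k H R (Coalgebra.comul (R := k) r ⊗ₜ[k] Coalgebra.comul (R := k) s)
  /-- The antipode of `R`. -/
  antipode : R →ₗ[k] R
  antipode_hom : IsYDHom k H antipode
  mul_antipode_rTensor_comul : LinearMap.mul' k R ∘ₗ antipode.rTensor R ∘ₗ Coalgebra.comul =
    Algebra.linearMap k R ∘ₗ Coalgebra.counit
  mul_antipode_lTensor_comul : LinearMap.mul' k R ∘ₗ antipode.lTensor R ∘ₗ Coalgebra.comul =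
    Algebra.linearMap k R ∘ₗ Coalgebra.counit

/-- The underlying vector space `R ⊗ H` of the bosonization `R # H`. -/
def Bosonization (R : Type w) [AddCommGroup R] [Module k R] : Type (max w v) := R ⊗[k] H

instance (R : Type w) [AddCommGroup R] [Module k R] : AddCommGroup (Bosonization k H R) :=
  inferInstanceAs (AddCommGroup (R ⊗[k] H))

instance (R : Type w) [AddCommGroup R] [Module k R] : Module k (Bosonization k H R) :=
  inferInstanceAs (Module k (R ⊗[k] H))

/-- `R ⊗ H` as the vector space underlying `R # H`. -/
def Bosonization.of (R : Type w) [AddCommGroup R] [Module k R] :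
    R ⊗[k] H ≃ₗ[k] Bosonization k H R := LinearEquiv.refl k _

/-- The action of `R` on `R ⊗ H` by `r ⇀ (s ⊗ a) = r s ⊗ a`. -/
def smashLeft (R : Type w) [Ring R] [Algebra k R] :
    R →ₐ[k] Module.End k (R ⊗[k] H) :=
  (Module.endTensorEndAlgHom (R := k) (S := k) (A := k) (M := R) (N := H)).comp
    (Algebra.TensorProduct.includeLeft.comp (Algebra.lmul k R))

/-- The action of `H` on `R ⊗ H` by `h ⇀ (s ⊗ a) = h₁ · s ⊗ h₂ a`. -/
def smashRight (R : Type w) [Ring R] [Algebra k R] [YDStruct k H R] :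
    H →ₐ[k] Module.End k (R ⊗[k] H) :=
  (Module.endTensorEndAlgHom (R := k) (S := k) (A := k) (M := R) (N := H)).comp
    ((Algebra.TensorProduct.map act (Algebra.lmul k H)).comp (Bialgebra.comulAlgHom k H))

/-- The smash product `(r ⊗ h)(s ⊗ a) = r (h₁ · s) ⊗ h₂ a`. -/
def smashMul (R : Type w) [Ring R] [Algebra k R] [YDStruct k H R] :
    R ⊗[k] H →ₗ[k] R ⊗[k] H →ₗ[k] R ⊗[k] H :=
  pair (smashLeft k H R).toLinearMap (smashRight k H R).toLinearMap

/-- The smash coproduct `Δ(s ⊗ h) = (s⁽¹⁾ ⊗ (s⁽²⁾)₋₁ h₁) ⊗ ((s⁽²⁾)₀ ⊗ h₂)`. -/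
def smashComul (R : Type w) [Ring R] [Algebra k R] [Coalgebra k R] [YDStruct k H R] :
    R ⊗[k] H →ₗ[k] (R ⊗[k] H) ⊗[k] (R ⊗[k] H) :=
  ((LinearMap.mul' k H).lTensor R ∘ₗ
      (TensorProduct.assoc k R H H).toLinearMap).rTensor (R ⊗[k] H) ∘ₗ
    (TensorProduct.tensorTensorTensorComm k (R ⊗[k] H) R H H).toLinearMap ∘ₗ
    ((TensorProduct.assoc k R H R).symm.toLinearMap ∘ₗ
      (coact (k := k) (H := H) (V := R)).lTensor R).rTensor (H ⊗[k] H) ∘ₗ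
    TensorProduct.map Coalgebra.comul Coalgebra.comul

/-- The counit `s ⊗ h ↦ ε(s) ε(h)`. -/
def smashCounit (R : Type w) [Ring R] [Algebra k R] [Coalgebra k R] :
    R ⊗[k] H →ₗ[k] k :=
  pair Coalgebra.counit Coalgebra.counit

end Def

section Lemmas

variable {k : Type u} {H : Type v} [Field k] [Ring H] [HopfAlgebra k H]

section pairs

variable {V W B : Type*} [AddCommGroup V] [Module k V] [AddCommGroup W] [Module k W]
  [Semiring B] [Algebra k B]

@[simp]
theorem pair_tmul (f : V →ₗ[k] B) (g : W →ₗ[k] B) (v : V) (w : W) :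
    pair f g (v ⊗ₜ[k] w) = f v * g w := rfl

theorem pair_add_left (f f' : V →ₗ[k] B) (g : W →ₗ[k] B) :
    pair (f + f') g = pair f g + pair f' g := by
  ext; simp [add_mul]

theorem pair_zero_left (g : W →ₗ[k] B) : pair (0 : V →ₗ[k] B) g = 0 := by
  ext; simp

theorem pair_map {V' W' : Type*} [AddCommGroup V'] [Module k V'] [AddCommGroup W'] [Module k W']
    (f : V →ₗ[k] B) (g : W →ₗ[k] B) (p : V' →ₗ[k] V) (q : W' →ₗ[k] W) (x : V' ⊗[k] W') :
    pair f g (TensorProduct.map p q x) = pair (f ∘ₗ p) (g ∘ₗ q) x := by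
  induction x with
  | zero => simp
  | tmul => simp
  | add _ _ h1 h2 => simp [h1, h2]

theorem pair_rTensor {V' : Type*} [AddCommGroup V'] [Module k V']
    (f : V →ₗ[k] B) (g : W →ₗ[k] B) (p : V' →ₗ[k] V) (x : V' ⊗[k] W) :
    pair f g (p.rTensor W x) = pair (f ∘ₗ p) g x := pair_map f g p LinearMap.id x

theorem pair_lTensor {W' : Type*} [AddCommGroup W'] [Module k W']
    (f : V →ₗ[k] B) (g : W →ₗ[k] B) (q : W' →ₗ[k] W) (x : V ⊗[k] W') :
    pair f g (q.lTensor V x) = pair f (g ∘ₗ q) x := pair_map f g LinearMap.id q x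

theorem pair_assoc {U : Type*} [AddCommGroup U] [Module k U]
    (f : U →ₗ[k] B) (g : V →ₗ[k] B) (e : W →ₗ[k] B) (x : (U ⊗[k] V) ⊗[k] W) :
    pair f (pair g e) (TensorProduct.assoc k U V W x) = pair (pair f g) e x := by
  induction x with
  | zero => simp
  | tmul y w =>
    induction y with
    | zero => simp
    | tmul => simp [mul_assoc]
    | add _ _ h1 h2 => simp_all [TensorProduct.add_tmul]
  | add _ _ h1 h2 => simp [h1, h2]

theorem map_pair {B' : Type*} [Semiring B'] [Algebra k B'] (F : B →ₐ[k] B')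
    (f : V →ₗ[k] B) (g : W →ₗ[k] B) (x : V ⊗[k] W) :
    F (pair f g x) = pair (F.toLinearMap ∘ₗ f) (F.toLinearMap ∘ₗ g) x := by
  induction x with
  | zero => simp
  | tmul => simp
  | add _ _ h1 h2 => simp [h1, h2]

theorem mul_pair (b : B) (f : V →ₗ[k] B) (g : W →ₗ[k] B) (x : V ⊗[k] W) :
    b * pair f g x = pair (LinearMap.mulLeft k b ∘ₗ f) g x := by
  induction x with
  | zero => simp
  | tmul => simp [mul_assoc]
  | add _ _ h1 h2 => simp [h1, h2, mul_add]

theorem pair_mul (b : B) (f : V →ₗ[k] B) (g : W →ₗ[k] B) (x : V ⊗[k] W) :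
    pair f g x * b = pair f (LinearMap.mulRight k b ∘ₗ g) x := by
  induction x with
  | zero => simp
  | tmul => simp [mul_assoc]
  | add _ _ h1 h2 => simp [h1, h2, add_mul]

variable (k) in
/-- The map `a ↦ ε(a) b` for an element `b` of an algebra. -/
def epsMap {C : Type*} [AddCommGroup C] [Module k C] [Coalgebra k C] (b : B) : C →ₗ[k] B :=
  (LinearMap.toSpanSingleton k B b) ∘ₗ Coalgebra.counit

@[simp] theorem epsMap_apply {C : Type*} [AddCommGroup C] [Module k C] [Coalgebra k C] (b : B)
    (c : C) : epsMap k b c = Coalgebra.counit (R := k) c • b := rfl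

@[simp]
theorem endTensor_tmul (f : Module.End k V) (g : Module.End k W) (v : V) (w : W) :
    Module.endTensorEndAlgHom (R := k) (S := k) (A := k) (f ⊗ₜ[k] g) (v ⊗ₜ[k] w) =
      f v ⊗ₜ[k] g w := rfl

section coalg

variable {C : Type*} [AddCommGroup C] [Module k C] [Coalgebra k C]

open Coalgebra

theorem comul_assoc_pair (f g e : C →ₗ[k] B) (c : C) :
    pair f (pair g e ∘ₗ comul) (comul c) = pair (pair f g ∘ₗ comul) e (comul c) := by
  rw [← pair_lTensor, ← pair_rTensor, ← pair_assoc, ← Coalgebra.coassoc_apply]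

theorem pair_eps_left (b : B) (f : C →ₗ[k] B) (c : C) :
    pair (epsMap k b) f (comul c) = b * f c := by
  rw [epsMap, ← pair_rTensor, Coalgebra.rTensor_counit_comul]; simp

theorem pair_eps_right (b : B) (f : C →ₗ[k] B) (c : C) :
    pair f (epsMap k b) (comul c) = f c * b := by
  rw [epsMap, ← pair_lTensor, Coalgebra.lTensor_counit_comul]; simp

end coalg

section coact

open YDStruct

variable [YetterDrinfeldModule k H V]

theorem coact_assoc_pair (f g : H →ₗ[k] B) (e : V →ₗ[k] B) (v : V) :
    pair f (pair g e ∘ₗ coact) (coact v) =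
      pair (pair f g ∘ₗ Coalgebra.comul) e (coact v) := by
  rw [← pair_lTensor, ← pair_rTensor, ← pair_assoc]
  exact congrArg _ (LinearMap.congr_fun (YetterDrinfeldModule.coact_coassoc (k := k) (H := H)) v).symm

theorem pair_eps_coact (b : B) (f : V →ₗ[k] B) (v : V) :
    pair (epsMap k b) f (coact (H := H) v) = b * f v := by
  rw [epsMap, ← pair_rTensor]
  erw [LinearMap.congr_fun (YetterDrinfeldModule.coact_counit (k := k) (H := H)) v]
  simp

end coact

end pairs

section yd

open YDStruct

variable {V : Type*} [AddCommGroup V] [Module k V] {B : Type*} [Semiring B] [Algebra k B]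

variable (H) in
/-- The map `h ↦ h · v`. -/
def actOn [YDStruct k H V] (v : V) : H →ₗ[k] V := (act (k := k) (H := H)).toLinearMap.flip v

@[simp] theorem actOn_apply [YDStruct k H V] (v : V) (h : H) : actOn (k := k) H v h = act (k := k) h v := rfl

/-- The diagonal action `h ⇀ (x ⊗ v) = h₁ x ⊗ h₂ · v` on `H ⊗ V`. -/
def diagAct [YDStruct k H V] : H →ₐ[k] Module.End k (H ⊗[k] V) :=
  (Module.endTensorEndAlgHom (R := k) (S := k) (A := k) (M := H) (N := V)).comp
    ((Algebra.TensorProduct.map (Algebra.lmul k H) act).comp (Bialgebra.comulAlgHom k H))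

theorem pair_diagAct [YDStruct k H V] (g : H →ₐ[k] B) (f : V →ₗ[k] B) (h y : H) (w : V) :
    pair g.toLinearMap f (diagAct (k := k) h (y ⊗ₜ w)) =
      pair (LinearMap.mulRight k (g y) ∘ₗ g.toLinearMap) (f ∘ₗ actOn H w)
        (Coalgebra.comul (R := k) h) := by
  change pair g.toLinearMap f (Module.endTensorEndAlgHom (R := k) (S := k) (A := k)
    (Algebra.TensorProduct.map (Algebra.lmul k H) act (Coalgebra.comul (R := k) h))
    (y ⊗ₜ[k] w)) = _
  induction Coalgebra.comul (R := k) h with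
  | zero => simp
  | tmul a b => simp
  | add _ _ h1 h2 => simp only [map_add, LinearMap.add_apply, add_mul, mul_add, h1, h2]

theorem pair_ydTwist [YDStruct k H V] (g : H →ₐ[k] B) (f : V →ₗ[k] B)
    (hc : ∀ x v, Commute (g x) (f v)) (Z : (H ⊗[k] H) ⊗[k] H) (y : H) (w : V) :
    pair g.toLinearMap f (ydTwist k H V Z (y ⊗ₜ w)) =
      pair (pair (LinearMap.mulRight k (g y) ∘ₗ g.toLinearMap) (f ∘ₗ actOn H w))
        (g.toLinearMap ∘ₗ HopfAlgebra.antipode k) Z := by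
  unfold ydTwist
  induction Z with
  | zero => simp
  | tmul ab c =>
    induction ab with
    | zero => simp
    | tmul a b =>
      have := (hc (HopfAlgebra.antipode k c) (act (k := k) b w)).eq
      simp [mul_assoc, this]
    | add _ _ h1 h2 => simp_all only [TensorProduct.add_tmul, map_add, LinearMap.add_apply]
  | add _ _ h1 h2 => simp only [map_add, LinearMap.add_apply, add_mul, mul_add, h1, h2]

theorem pair_antipode_left (g : H →ₐ[k] B) (h : H) :
    pair (g.toLinearMap ∘ₗ HopfAlgebra.antipode k) g.toLinearMap (Coalgebra.comul (R := k) h) =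
      Coalgebra.counit (R := k) h • 1 := by
  have := congrArg g (HopfAlgebra.mul_antipode_rTensor_comul_apply (R := k) h)
  rw [AlgHom.commutes, ← Algebra.algebraMap_eq_smul_one] at *
  rw [← this]
  induction Coalgebra.comul (R := k) h with
  | zero => simp
  | tmul a b => simp
  | add _ _ h1 h2 => simp only [map_add, LinearMap.add_apply, add_mul, mul_add, h1, h2]

theorem pair_antipode_right (g : H →ₐ[k] B) (h : H) :
    pair g.toLinearMap (g.toLinearMap ∘ₗ HopfAlgebra.antipode k) (Coalgebra.comul (R := k) h) =
      Coalgebra.counit (R := k) h • 1 := by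
  have := congrArg g (HopfAlgebra.mul_antipode_lTensor_comul_apply (R := k) h)
  rw [AlgHom.commutes, ← Algebra.algebraMap_eq_smul_one] at *
  rw [← this]
  induction Coalgebra.comul (R := k) h with
  | zero => simp
  | tmul a b => simp
  | add _ _ h1 h2 => simp only [map_add, LinearMap.add_apply, add_mul, mul_add, h1, h2]

/-- `(h₁ · v)₋₁ h₂ ⊗ (h₁ · v)₀ = h₁ v₋₁ ⊗ h₂ · v₀`, mapped to an algebra. -/
theorem yd_pair [YetterDrinfeldModule k H V] (g : H →ₐ[k] B) (f : V →ₗ[k] B)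
    (hc : ∀ x v, Commute (g x) (f v)) (h : H) (v : V) :
    pair (pair g.toLinearMap f ∘ₗ coact ∘ₗ actOn H v) g.toLinearMap (Coalgebra.comul (R := k) h) =
      pair g.toLinearMap f (diagAct h (coact v)) := by
  have key : ∀ X : H ⊗[k] V,
      pair (pair g.toLinearMap f ∘ₗ LinearMap.applyₗ X ∘ₗ ydTwist k H V ∘ₗ
        (Coalgebra.comul (R := k) (A := H)).rTensor H ∘ₗ Coalgebra.comul) g.toLinearMap
        (Coalgebra.comul (R := k) h) = pair g.toLinearMap f (diagAct h X) := by
    intro X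
    induction X with
    | zero =>
      rw [map_zero, map_zero]
      induction Coalgebra.comul (R := k) h with
      | zero => simp
      | tmul a b => simp
      | add _ _ h1 h2 => simp only [map_add, LinearMap.add_apply, h1, h2, add_zero, map_zero]
    | add X Y hX hY =>
      rw [LinearMap.map_add (diagAct h), map_add (pair g.toLinearMap f), ← hX, ← hY]
      induction Coalgebra.comul (R := k) h with
      | zero => simp
      | tmul a b => simp [add_mul]
      | add _ _ h1 h2 =>
        simp only [map_add] at *
        rw [h1, h2]; abel
    | tmul y w =>
      rw [pair_diagAct]
      have : (pair g.toLinearMap f ∘ₗ LinearMap.applyₗ (y ⊗ₜ w) ∘ₗ ydTwist k H V ∘ₗ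
          (Coalgebra.comul (R := k) (A := H)).rTensor H ∘ₗ Coalgebra.comul) =
          pair (pair (LinearMap.mulRight k (g y) ∘ₗ g.toLinearMap) (f ∘ₗ actOn H w) ∘ₗ
            Coalgebra.comul) (g.toLinearMap ∘ₗ HopfAlgebra.antipode k) ∘ₗ Coalgebra.comul := by
        ext x
        simp only [LinearMap.comp_apply, LinearMap.applyₗ_apply_apply]
        rw [pair_ydTwist g f hc, pair_rTensor]
      rw [this, ← comul_assoc_pair]
      have h2 : pair (g.toLinearMap ∘ₗ HopfAlgebra.antipode k) g.toLinearMap ∘ₗ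
          Coalgebra.comul = epsMap k (1 : B) := by
        ext x; simpa using pair_antipode_left g x
      rw [h2, pair_eps_right, mul_one]; rfl
  rw [← key]
  congr 2
  ext x
  simp [YetterDrinfeldModule.compat]

end yd

section smash

open YDStruct

variable {R : Type w} [Ring R] [Algebra k R] [Coalgebra k R] [BraidedHopfAlgebra k H R]

theorem act_one (h : H) : act (k := k) h (1 : R) = Coalgebra.counit (R := k) h • 1 := by
  have := (BraidedHopfAlgebra.unit_hom (k := k) (H := H) (R := R)).1 h 1
  simp only [Algebra.linearMap_apply, map_one] at this
  rw [← this]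
  change algebraMap k R (algebraMap k (Module.End k k) (Coalgebra.counit (R := k) h) 1) = _
  simp [Algebra.algebraMap_eq_smul_one]

theorem act_mul {B : Type*} [Semiring B] [Algebra k B] (f : R →ₐ[k] B) (h : H) (r s : R) :
    f (act (k := k) h (r * s)) =
      pair (f.toLinearMap ∘ₗ actOn H r) (f.toLinearMap ∘ₗ actOn H s) (Coalgebra.comul h) := by
  have := (BraidedHopfAlgebra.mul_hom (k := k) (H := H) (R := R)).1 h (r ⊗ₜ s)
  rw [LinearMap.mul'_apply] at this
  have h2 : act (k := k) h (r * s) = LinearMap.mul' k R (act (k := k) h (r ⊗ₜ[k] s)) := this.symm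
  rw [h2]
  change f (LinearMap.mul' k R (Module.endTensorEndAlgHom (R := k) (S := k) (A := k)
    (Algebra.TensorProduct.map act act (Coalgebra.comul (R := k) h)) (r ⊗ₜ[k] s))) = _
  induction Coalgebra.comul (R := k) h with
  | zero => simp
  | tmul a b => simp
  | add _ _ h1 h2 => simp only [map_add, LinearMap.add_apply, add_mul, mul_add, h1, h2]

theorem smashLeft_apply (r : R) (x : R ⊗[k] H) :
    smashLeft k H R r x = (r ⊗ₜ[k] (1 : H)) * x := by
  induction x with
  | zero => simp
  | tmul => simp [smashLeft]
  | add _ _ h1 h2 => simp only [map_add, LinearMap.add_apply, add_mul, mul_add, h1, h2]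

theorem smashRight_apply (h : H) (t : R) (a : H) :
    smashRight k H R h (t ⊗ₜ a) =
      pair ((Algebra.TensorProduct.includeLeft : R →ₐ[k] R ⊗[k] H).toLinearMap ∘ₗ actOn H t)
        ((Algebra.TensorProduct.includeRight : H →ₐ[k] R ⊗[k] H).toLinearMap ∘ₗ
          LinearMap.mulRight k a) (Coalgebra.comul h) := by
  change Module.endTensorEndAlgHom (R := k) (S := k) (A := k)
    (Algebra.TensorProduct.map act (Algebra.lmul k H) (Coalgebra.comul (R := k) h)) (t ⊗ₜ[k] a) = _
  induction Coalgebra.comul (R := k) h with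
  | zero => simp
  | tmul a b => simp
  | add _ _ h1 h2 => simp only [map_add, LinearMap.add_apply, add_mul, mul_add, h1, h2]

theorem smashRight_mul_smashLeft (h : H) (s : R) :
    smashRight k H R h * smashLeft k H R s =
      pair ((smashLeft k H R).toLinearMap ∘ₗ actOn H s) (smashRight k H R).toLinearMap
        (Coalgebra.comul h) := by
  apply TensorProduct.ext'
  intro t a
  rw [Module.End.mul_apply, smashLeft_apply, Algebra.TensorProduct.tmul_mul_tmul, one_mul,
    smashRight_apply]
  have h1 : ((Algebra.TensorProduct.includeLeft : R →ₐ[k] R ⊗[k] H).toLinearMap ∘ₗ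
      actOn H (s * t)) =
      pair ((Algebra.TensorProduct.includeLeft : R →ₐ[k] R ⊗[k] H).toLinearMap ∘ₗ actOn H s)
        ((Algebra.TensorProduct.includeLeft : R →ₐ[k] R ⊗[k] H).toLinearMap ∘ₗ actOn H t) ∘ₗ
        Coalgebra.comul := by
    ext x
    exact act_mul (Algebra.TensorProduct.includeLeft : R →ₐ[k] R ⊗[k] H) x s t
  rw [h1, ← comul_assoc_pair]
  have h2 : pair ((Algebra.TensorProduct.includeLeft : R →ₐ[k] R ⊗[k] H).toLinearMap ∘ₗ actOn H t)
        ((Algebra.TensorProduct.includeRight : H →ₐ[k] R ⊗[k] H).toLinearMap ∘ₗ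
          LinearMap.mulRight k a) ∘ₗ Coalgebra.comul =
        LinearMap.applyₗ (t ⊗ₜ a) ∘ₗ (smashRight k H R).toLinearMap := by
    ext x
    exact (smashRight_apply x t a).symm
  rw [h2]
  induction Coalgebra.comul (R := k) h with
  | zero => simp
  | tmul a b => simp [smashLeft_apply]
  | add _ _ h1 h2 => simp only [map_add, LinearMap.add_apply, add_mul, mul_add, h1, h2]

theorem smashMul_one (x : R ⊗[k] H) : smashMul k H R x (1 ⊗ₜ 1) = x := by
  induction x with
  | zero => simp
  | add _ _ h1 h2 => simp only [map_add, LinearMap.add_apply, add_mul, mul_add, h1, h2]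
  | tmul r h =>
    simp only [smashMul, pair_tmul, Module.End.mul_apply, AlgHom.toLinearMap_apply]
    rw [smashRight_apply]
    have : ((Algebra.TensorProduct.includeLeft : R →ₐ[k] R ⊗[k] H).toLinearMap ∘ₗ
        actOn H (1 : R)) = epsMap k 1 := by
      ext x; simp [act_one, TensorProduct.smul_tmul', Algebra.TensorProduct.one_def]
    rw [this, pair_eps_left, smashLeft_apply]
    simp

theorem one_smashMul (x : R ⊗[k] H) : smashMul k H R (1 ⊗ₜ 1) x = x := by
  simp [smashMul]

theorem smashMul_smashMul (x y : R ⊗[k] H) :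
    smashMul k H R (smashMul k H R x y) = smashMul k H R x * smashMul k H R y := by
  have hl : ∀ (r : R) (y : R ⊗[k] H), smashMul k H R (smashLeft k H R r y) =
      smashLeft k H R r * smashMul k H R y := by
    intro r y
    induction y with
    | zero => simp
    | add _ _ h1 h2 => simp only [map_add, LinearMap.add_apply, add_mul, mul_add, h1, h2]
    | tmul s a => simp [smashLeft_apply, smashMul, mul_assoc]
  have hr : ∀ (h : H) (y : R ⊗[k] H), smashMul k H R (smashRight k H R h y) =
      smashRight k H R h * smashMul k H R y := by
    intro h y
    induction y with
    | zero => simp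
    | add _ _ h1 h2 => simp only [map_add, LinearMap.add_apply, add_mul, mul_add, h1, h2]
    | tmul s a =>
      rw [smashRight_apply]
      conv_rhs => rw [smashMul, pair_tmul, ← mul_assoc, AlgHom.toLinearMap_apply,
        smashRight_mul_smashLeft]
      induction Coalgebra.comul (R := k) h with
      | zero => simp
      | tmul a b => simp [smashMul, mul_assoc]
      | add _ _ h1 h2 => simp only [map_add, LinearMap.add_apply, add_mul, mul_add, h1, h2]
  induction x with
  | zero => simp
  | add _ _ h1 h2 => simp only [map_add, LinearMap.add_apply, add_mul, mul_add, h1, h2]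
  | tmul r h =>
    have : ∀ z, smashMul k H R (r ⊗ₜ h) z = smashLeft k H R r (smashRight k H R h z) :=
      fun z => rfl
    rw [this, hl, hr]
    rfl

instance : Ring (Bosonization k H R) where
  __ := (inferInstance : AddCommGroup (Bosonization k H R))
  mul x y := smashMul k H R x y
  one := (1 : R) ⊗ₜ[k] (1 : H)
  mul_assoc x y z := LinearMap.congr_fun (smashMul_smashMul x y) z
  one_mul := one_smashMul
  mul_one := smashMul_one
  left_distrib x y z := (smashMul k H R x).map_add y z
  right_distrib x y z := LinearMap.congr_fun ((smashMul k H R).map_add x y) z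
  zero_mul x := LinearMap.congr_fun (smashMul k H R).map_zero x
  mul_zero x := (smashMul k H R x).map_zero

instance : Algebra k (Bosonization k H R) :=
  Algebra.ofModule (fun c x y => LinearMap.congr_fun ((smashMul k H R).map_smul c x) y)
    (fun c x y => (smashMul k H R x).map_smul c y)

theorem of_mul_of (x y : R ⊗[k] H) :
    Bosonization.of k H R x * Bosonization.of k H R y =
      Bosonization.of k H R (smashMul k H R x y) := rfl

theorem smashMul_tmul (r : R) (h : H) (y : R ⊗[k] H) :
    smashMul k H R (r ⊗ₜ h) y = (r ⊗ₜ[k] (1 : H)) * smashRight k H R h y := by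
  rw [← smashLeft_apply]; rfl

theorem smashMul_RR (r s : R) :
    smashMul k H R (r ⊗ₜ 1) (s ⊗ₜ 1) = (r * s) ⊗ₜ 1 := by
  simp [smashMul_tmul]

theorem smashMul_RH (r : R) (h : H) :
    smashMul k H R (r ⊗ₜ 1) (1 ⊗ₜ h) = r ⊗ₜ h := by
  simp [smashMul_tmul]

theorem smashMul_HR (h : H) (s : R) :
    smashMul k H R (1 ⊗ₜ h) (s ⊗ₜ 1) =
      TensorProduct.map (actOn H s) LinearMap.id (Coalgebra.comul h) := by
  rw [smashMul_tmul, smashRight_apply, ← Algebra.TensorProduct.one_def, one_mul]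
  induction Coalgebra.comul (R := k) h with
  | zero => simp
  | tmul a b => simp
  | add _ _ h1 h2 => simp only [map_add, h1, h2]

theorem smashMul_HH (h a : H) :
    smashMul k H R (1 ⊗ₜ h) (1 ⊗ₜ a) = (1 : R) ⊗ₜ (h * a) := by
  rw [smashMul_tmul, smashRight_apply]
  have : ((Algebra.TensorProduct.includeLeft : R →ₐ[k] R ⊗[k] H).toLinearMap ∘ₗ
      actOn H (1 : R)) = epsMap k 1 := by
    ext x; simp [act_one, TensorProduct.smul_tmul', Algebra.TensorProduct.one_def]
  rw [this, pair_eps_left]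
  simp

variable (k H R) in
/-- The inclusion `r ↦ r # 1`. -/
def inR : R →ₐ[k] Bosonization k H R :=
  AlgHom.ofLinearMap ((Bosonization.of k H R).toLinearMap ∘ₗ (TensorProduct.mk k R H).flip 1) rfl
    (fun r s => by
      simp only [LinearMap.comp_apply, LinearMap.flip_apply, TensorProduct.mk_apply,
        LinearEquiv.coe_coe]
      rw [of_mul_of, smashMul_RR])

variable (k H R) in
/-- The inclusion `h ↦ 1 # h`. -/
def inH : H →ₐ[k] Bosonization k H R :=
  AlgHom.ofLinearMap ((Bosonization.of k H R).toLinearMap ∘ₗ TensorProduct.mk k R H 1) rfl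
    (fun h a => by
      simp only [LinearMap.comp_apply, TensorProduct.mk_apply, LinearEquiv.coe_coe]
      rw [of_mul_of, smashMul_HH])

theorem inR_apply (r : R) : inR k H R r = Bosonization.of k H R (r ⊗ₜ 1) := rfl

theorem inH_apply (h : H) : inH k H R h = Bosonization.of k H R (1 ⊗ₜ h) := rfl

theorem inR_mul_inH (r : R) (h : H) :
    inR k H R r * inH k H R h = Bosonization.of k H R (r ⊗ₜ h) := by
  rw [inR_apply, inH_apply, of_mul_of, smashMul_RH]

theorem inH_mul_inR (h : H) (s : R) :
    inH k H R h * inR k H R s =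
      pair ((inR k H R).toLinearMap ∘ₗ actOn H s) (inH k H R).toLinearMap (Coalgebra.comul h) := by
  rw [inR_apply, inH_apply, of_mul_of, smashMul_HR]
  induction Coalgebra.comul (R := k) h with
  | zero => simp
  | tmul a b => simp [inR_mul_inH]
  | add _ _ h1 h2 => simp only [map_add, h1, h2]

/-- Two linear maps out of `R # H` agree if they agree on all `(r # 1)(1 # h)`. -/
theorem boson_ext {V : Type*} [AddCommMonoid V] [Module k V] {f g : Bosonization k H R →ₗ[k] V}
    (h : ∀ r a, f (inR k H R r * inH k H R a) = g (inR k H R r * inH k H R a)) : f = g := by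
  have : f ∘ₗ (Bosonization.of k H R).toLinearMap = g ∘ₗ (Bosonization.of k H R).toLinearMap := by
    apply TensorProduct.ext'
    intro r a
    simpa [inR_mul_inH] using h r a
  ext x
  exact LinearMap.congr_fun this x

section general

variable {B : Type*} [Semiring B] [Algebra k B]

theorem coact_one : coact (k := k) (H := H) (1 : R) = 1 ⊗ₜ 1 := by
  have := LinearMap.congr_fun (BraidedHopfAlgebra.unit_hom (k := k) (H := H) (R := R)).2 1
  simp only [LinearMap.comp_apply, Algebra.linearMap_apply, map_one] at this
  rw [this]
  change (Algebra.linearMap k R).lTensor H ((1 : H) ⊗ₜ (1 : k)) = _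
  simp

theorem coact_pair_mul (G : H →ₐ[k] B) (F : R →ₐ[k] B) (hc : ∀ x r, Commute (G x) (F r))
    (r s : R) :
    pair G.toLinearMap F.toLinearMap (coact (r * s)) =
      pair G.toLinearMap F.toLinearMap (coact r) * pair G.toLinearMap F.toLinearMap (coact s) := by
  have := LinearMap.congr_fun (BraidedHopfAlgebra.mul_hom (k := k) (H := H) (R := R)).2 (r ⊗ₜ s)
  simp only [LinearMap.comp_apply, LinearMap.mul'_apply] at this
  rw [this, pair_lTensor]
  change pair _ _ ((LinearMap.mul' k H).rTensor (R ⊗[k] R)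
    (TensorProduct.tensorTensorTensorComm k H R H R (coact r ⊗ₜ coact s))) = _
  rw [pair_rTensor]
  induction coact (k := k) (H := H) r with
  | zero => simp
  | add _ _ h1 h2 => simp only [TensorProduct.add_tmul, map_add, add_mul, h1, h2]
  | tmul x u =>
    induction coact (k := k) (H := H) s with
    | zero => simp
    | add _ _ h1 h2 => simp only [TensorProduct.tmul_add, map_add, mul_add, h1, h2]
    | tmul y w =>
      simp only [TensorProduct.tensorTensorTensorComm_tmul, pair_tmul, LinearMap.comp_apply,
        LinearMap.mul'_apply, AlgHom.toLinearMap_apply, map_mul, mul_assoc]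
      rw [← mul_assoc (G y), (hc y u).eq, mul_assoc]

/-- Colinearity of the comultiplication of `R`, mapped to an algebra. -/
theorem coact_pair_comul (G : H →ₐ[k] B) (f1 f2 : R →ₗ[k] B) (hc : ∀ x r, Commute (G x) (f1 r))
    (s : R) :
    pair G.toLinearMap (pair f1 f2 ∘ₗ Coalgebra.comul) (coact s) =
      pair (pair G.toLinearMap f1 ∘ₗ coact) (pair G.toLinearMap f2 ∘ₗ coact)
        (Coalgebra.comul s) := by
  have := LinearMap.congr_fun (BraidedHopfAlgebra.comul_hom (k := k) (H := H) (R := R)).2 s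
  simp only [LinearMap.comp_apply] at this
  rw [← pair_lTensor, ← this]
  induction Coalgebra.comul (R := k) s with
  | zero => simp
  | add _ _ h1 h2 => simp only [map_add, h1, h2]
  | tmul r s =>
    change pair _ _ ((LinearMap.mul' k H).rTensor (R ⊗[k] R)
      (TensorProduct.tensorTensorTensorComm k H R H R (coact r ⊗ₜ coact s))) = _
    rw [pair_rTensor, pair_tmul, LinearMap.comp_apply, LinearMap.comp_apply]
    induction coact (k := k) (H := H) r with
    | zero => simp
    | add _ _ h1 h2 => simp only [TensorProduct.add_tmul, map_add, add_mul, h1, h2]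
    | tmul x u =>
      induction coact (k := k) (H := H) s with
      | zero => simp
      | add _ _ h1 h2 => simp only [TensorProduct.tmul_add, map_add, mul_add, h1, h2]
      | tmul y w =>
        simp only [TensorProduct.tensorTensorTensorComm_tmul, pair_tmul, LinearMap.comp_apply,
          LinearMap.mul'_apply, AlgHom.toLinearMap_apply, map_mul, mul_assoc]
        rw [← mul_assoc (G y), (hc y u).eq, mul_assoc]

theorem coact_counit_pair (g : H →ₗ[k] B) (b : B) (s : R) :
    pair g (epsMap k b) (coact s) = Coalgebra.counit (R := k) s • (g 1 * b) := by
  have := LinearMap.congr_fun (BraidedHopfAlgebra.counit_hom (k := k) (H := H) (R := R)).2 s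
  simp only [LinearMap.comp_apply] at this
  rw [epsMap, ← pair_lTensor, ← this]
  change pair g _ ((1 : H) ⊗ₜ[k] Coalgebra.counit (R := k) s) = _
  simp

/-- `Δ(h · s) = h₁ · s⁽¹⁾ ⊗ h₂ · s⁽²⁾`, mapped to an algebra. -/
theorem comul_act (f1 f2 : R →ₗ[k] B) (h : H) (s : R) :
    pair f1 f2 (Coalgebra.comul (act (k := k) h s)) =
      pair f1 f2 (act (k := k) h (Coalgebra.comul (R := k) s)) := by
  rw [(BraidedHopfAlgebra.comul_hom (k := k) (H := H) (R := R)).1 h s]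

theorem pair_act_tmul (f1 f2 : R →ₗ[k] B) (h : H) (s t : R) :
    pair f1 f2 (act (k := k) h (s ⊗ₜ[k] t)) =
      pair (f1 ∘ₗ actOn H s) (f2 ∘ₗ actOn H t) (Coalgebra.comul h) := by
  change pair f1 f2 (Module.endTensorEndAlgHom (R := k) (S := k) (A := k)
    (Algebra.TensorProduct.map act act (Coalgebra.comul (R := k) h)) (s ⊗ₜ[k] t)) = _
  induction Coalgebra.comul (R := k) h with
  | zero => simp
  | tmul a b => simp
  | add _ _ h1 h2 => simp only [map_add, LinearMap.add_apply, h1, h2]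

/-- If `f2(b) f1(c) = f1(b₋₁ · c) f2(b₀)`, then `f1 * f2` is multiplicative. -/
theorem conv_mul (f1 f2 : R →ₐ[k] B)
    (hx : ∀ b c, f2 b * f1 c = pair (f1.toLinearMap ∘ₗ actOn H c) f2.toLinearMap (coact b))
    (r s : R) :
    pair f1.toLinearMap f2.toLinearMap (Coalgebra.comul (r * s)) =
      pair f1.toLinearMap f2.toLinearMap (Coalgebra.comul r) *
        pair f1.toLinearMap f2.toLinearMap (Coalgebra.comul s) := by
  rw [BraidedHopfAlgebra.comul_mul (H := H)]
  induction Coalgebra.comul (R := k) r with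
  | zero => simp
  | add _ _ h1 h2 => simp only [TensorProduct.add_tmul, map_add, add_mul, h1, h2]
  | tmul a b =>
    induction Coalgebra.comul (R := k) s with
    | zero => simp
    | add _ _ h1 h2 => simp only [TensorProduct.tmul_add, map_add, mul_add, h1, h2]
    | tmul c d =>
      have e : pair f1.toLinearMap f2.toLinearMap ((a ⊗ₜ[k] b)) *
          pair f1.toLinearMap f2.toLinearMap (c ⊗ₜ[k] d) = f1 a * (f2 b * f1 c) * f2 d := by
        simp [mul_assoc]
      rw [e, hx]
      simp only [braidedMul, braiding, LinearMap.comp_apply, LinearEquiv.coe_coe,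
        TensorProduct.assoc_tmul, LinearMap.lTensor_tmul, TensorProduct.assoc_symm_tmul,
        LinearMap.rTensor_tmul]
      induction coact (k := k) (H := H) b with
      | zero => simp
      | add _ _ h1 h2 =>
        simp only [TensorProduct.add_tmul, TensorProduct.tmul_add, map_add, mul_add, add_mul, h1, h2]
      | tmul x u => simp [mul_assoc]

end general

section lift

variable {B : Type*} [Semiring B] [Algebra k B]

/-- `g(h) f(s) = f(h₁ · s) g(h₂)`. -/
def SmashRel (f : R →ₐ[k] B) (g : H →ₐ[k] B) : Prop :=
  ∀ (h : H) (s : R), g h * f s =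
    pair (f.toLinearMap ∘ₗ actOn H s) g.toLinearMap (Coalgebra.comul h)

/-- The universal property of the smash product. -/
def bosonLift (f : R →ₐ[k] B) (g : H →ₐ[k] B) (hr : SmashRel f g) : Bosonization k H R →ₐ[k] B :=
  AlgHom.ofLinearMap (pair f.toLinearMap g.toLinearMap ∘ₗ (Bosonization.of k H R).symm.toLinearMap)
    (by change pair f.toLinearMap g.toLinearMap ((1 : R) ⊗ₜ[k] (1 : H)) = 1; simp)
    (by
      set L := pair f.toLinearMap g.toLinearMap ∘ₗ (Bosonization.of k H R).symm.toLinearMap with hL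
      have h0 : ∀ r a, L (inR k H R r * inH k H R a) = f r * g a := by
        intro r a; simp [hL, inR_mul_inH]
      have h1 : ∀ r x, L (inR k H R r * x) = f r * L x := by
        intro r x
        have : L ∘ₗ LinearMap.mulLeft k (inR k H R r) = LinearMap.mulLeft k (f r) ∘ₗ L := by
          apply boson_ext
          intro s a
          simp only [LinearMap.comp_apply, LinearMap.mulLeft_apply, h0]
          rw [← mul_assoc, ← map_mul, h0, map_mul, mul_assoc]
        exact LinearMap.congr_fun this x
      have h2 : ∀ h x, L (inH k H R h * x) = g h * L x := by
        intro h x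
        have : L ∘ₗ LinearMap.mulLeft k (inH k H R h) = LinearMap.mulLeft k (g h) ∘ₗ L := by
          apply boson_ext
          intro s a
          simp only [LinearMap.comp_apply, LinearMap.mulLeft_apply, h0]
          rw [← mul_assoc, ← mul_assoc, hr, inH_mul_inR]
          induction Coalgebra.comul (R := k) h with
          | zero => simp
          | tmul x y =>
            simp only [pair_tmul, LinearMap.comp_apply, AlgHom.toLinearMap_apply, mul_assoc]
            rw [← map_mul, h0, map_mul]
          | add _ _ h1 h2 => simp only [map_add, add_mul, h1, h2]
        exact LinearMap.congr_fun this x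
      intro x y
      have : L ∘ₗ LinearMap.mulRight k y = LinearMap.mulRight k (L y) ∘ₗ L := by
        apply boson_ext
        intro s a
        simp only [LinearMap.comp_apply, LinearMap.mulRight_apply, mul_assoc, h0, h1, h2]
      exact LinearMap.congr_fun this x)

theorem bosonLift_mul (f : R →ₐ[k] B) (g : H →ₐ[k] B) (hr : SmashRel f g) (r : R) (h : H) :
    bosonLift f g hr (inR k H R r * inH k H R h) = f r * g h := by
  rw [inR_mul_inH]; rfl

@[simp]
theorem bosonLift_inR (f : R →ₐ[k] B) (g : H →ₐ[k] B) (hr : SmashRel f g) (r : R) :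
    bosonLift f g hr (inR k H R r) = f r := by
  have := bosonLift_mul f g hr r 1
  simpa using this

@[simp]
theorem bosonLift_inH (f : R →ₐ[k] B) (g : H →ₐ[k] B) (hr : SmashRel f g) (h : H) :
    bosonLift f g hr (inH k H R h) = g h := by
  have := bosonLift_mul f g hr 1 h
  simpa using this

theorem boson_algHom_ext {F G : Bosonization k H R →ₐ[k] B}
    (h1 : ∀ r, F (inR k H R r) = G (inR k H R r)) (h2 : ∀ a, F (inH k H R a) = G (inH k H R a)) :
    F = G := by
  apply AlgHom.toLinearMap_injective
  apply boson_ext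
  intro r a
  simp [h1, h2]

/-- The algebra map `s ↦ g(s₋₁) f(s₀)`. -/
def phi (G : H →ₐ[k] B) (F : R →ₐ[k] B) (hc : ∀ x r, Commute (G x) (F r)) : R →ₐ[k] B :=
  AlgHom.ofLinearMap (pair G.toLinearMap F.toLinearMap ∘ₗ coact)
    (by simp [coact_one]) (coact_pair_mul G F hc)

theorem phi_toLinearMap (G : H →ₐ[k] B) (F : R →ₐ[k] B) (hc : ∀ x r, Commute (G x) (F r)) :
    (phi G F hc).toLinearMap = pair G.toLinearMap F.toLinearMap ∘ₗ coact := rfl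

theorem phi_mul (E F : R →ₐ[k] B) (G : H →ₐ[k] B) (hr : SmashRel E G)
    (hc : ∀ x r, Commute (G x) (F r)) (hE : ∀ r s, Commute (E r) (F s)) (b c : R) :
    phi G F hc b * E c =
      pair (E.toLinearMap ∘ₗ actOn H c) (phi G F hc).toLinearMap (coact b) := by
  rw [phi_toLinearMap, coact_assoc_pair]
  have : pair (E.toLinearMap ∘ₗ actOn H c) G.toLinearMap ∘ₗ Coalgebra.comul =
      LinearMap.mulRight k (E c) ∘ₗ G.toLinearMap := by
    ext x; exact (hr x c).symm
  rw [this]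
  change pair G.toLinearMap F.toLinearMap (coact b) * E c = _
  induction coact (k := k) (H := H) b with
  | zero => simp
  | tmul x u => simp [mul_assoc, (hE c u).eq]
  | add _ _ h1 h2 => simp only [map_add, add_mul, h1, h2]

/-- The algebra map `s ↦ e(s⁽¹⁾) g((s⁽²⁾)₋₁) f((s⁽²⁾)₀)`. -/
def comulR (E F : R →ₐ[k] B) (G : H →ₐ[k] B) (hr : SmashRel E G)
    (hc : ∀ x r, Commute (G x) (F r)) (hE : ∀ r s, Commute (E r) (F s)) : R →ₐ[k] B :=
  AlgHom.ofLinearMap (pair E.toLinearMap (phi G F hc).toLinearMap ∘ₗ Coalgebra.comul)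
    (by simp [BraidedHopfAlgebra.comul_one (k := k) (H := H)])
    (conv_mul E (phi G F hc) (phi_mul E F G hr hc hE))

/-- The algebra map `h ↦ g(h₁) g'(h₂)`. -/
def comulH (G G' : H →ₐ[k] B) (hG : ∀ x y, Commute (G x) (G' y)) : H →ₐ[k] B :=
  (Algebra.TensorProduct.lift G G' hG).comp (Bialgebra.comulAlgHom k H)

theorem comulH_toLinearMap (G G' : H →ₐ[k] B) (hG : ∀ x y, Commute (G x) (G' y)) :
    (comulH G G' hG).toLinearMap = pair G.toLinearMap G'.toLinearMap ∘ₗ Coalgebra.comul := by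
  ext x
  change Algebra.TensorProduct.lift G G' hG (Coalgebra.comul (R := k) x) = pair _ _ _
  induction Coalgebra.comul (R := k) x with
  | zero => simp
  | tmul a b => simp
  | add _ _ h1 h2 => simp only [map_add, h1, h2]

theorem comulH_apply (G G' : H →ₐ[k] B) (hG : ∀ x y, Commute (G x) (G' y)) (h : H) :
    comulH G G' hG h = pair G.toLinearMap G'.toLinearMap (Coalgebra.comul h) :=
  LinearMap.congr_fun (comulH_toLinearMap G G' hG) h

theorem smashRel_comul (E F : R →ₐ[k] B) (G G' : H →ₐ[k] B) (hr : SmashRel E G)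
    (hr' : SmashRel F G')
    (hc : ∀ x r, Commute (G x) (F r)) (hE : ∀ r s, Commute (E r) (F s))
    (hG : ∀ x y, Commute (G x) (G' y)) (hEG : ∀ r x, Commute (E r) (G' x)) :
    SmashRel (comulR E F G hr hc hE) (comulH G G' hG) := by
  have s1 : ∀ h s, pair (E.toLinearMap ∘ₗ actOn H s) (comulH G G' hG).toLinearMap
      (Coalgebra.comul h) = comulH G G' hG h * E s := by
    intro h s
    rw [comulH_toLinearMap, comul_assoc_pair]
    have : pair (E.toLinearMap ∘ₗ actOn H s) G.toLinearMap ∘ₗ Coalgebra.comul =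
        LinearMap.mulRight k (E s) ∘ₗ G.toLinearMap := by
      ext x; exact (hr x s).symm
    rw [this, comulH_apply]
    induction Coalgebra.comul (R := k) h with
    | zero => simp
    | tmul x u => simp [mul_assoc, (hEG s u).eq]
    | add _ _ h1 h2 => simp only [map_add, add_mul, h1, h2]
  have s2 : ∀ h t, pair ((phi G F hc).toLinearMap ∘ₗ actOn H t) (comulH G G' hG).toLinearMap
      (Coalgebra.comul h) = comulH G G' hG h * phi G F hc t := by
    intro h t
    rw [comulH_toLinearMap, comul_assoc_pair]
    have : pair ((phi G F hc).toLinearMap ∘ₗ actOn H t) G.toLinearMap ∘ₗ Coalgebra.comul =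
        pair G.toLinearMap F.toLinearMap ∘ₗ LinearMap.applyₗ (coact t) ∘ₗ
          (diagAct (k := k) (H := H) (V := R)).toLinearMap := by
      ext x; exact yd_pair G F.toLinearMap hc x t
    rw [this, comulH_apply]
    change _ = _ * pair G.toLinearMap F.toLinearMap (coact t)
    induction coact (k := k) (H := H) t with
    | zero => simp [pair_zero_left]
    | add _ _ h1 h2 =>
      simp only [map_add, mul_add, LinearMap.add_comp, LinearMap.comp_add, pair_add_left,
        LinearMap.add_apply, h1, h2]
    | tmul y w =>
      have e1 : pair G.toLinearMap F.toLinearMap ∘ₗ LinearMap.applyₗ (y ⊗ₜ w) ∘ₗ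
          (diagAct (k := k) (H := H) (V := R)).toLinearMap =
          pair (LinearMap.mulRight k (G y) ∘ₗ G.toLinearMap) (F.toLinearMap ∘ₗ actOn H w) ∘ₗ
            Coalgebra.comul := by
        ext x; exact pair_diagAct G F.toLinearMap x y w
      have e2 : pair (F.toLinearMap ∘ₗ actOn H w) G'.toLinearMap ∘ₗ Coalgebra.comul =
          LinearMap.mulRight k (F w) ∘ₗ G'.toLinearMap := by
        ext x; exact (hr' x w).symm
      rw [e1, ← comul_assoc_pair, e2]
      induction Coalgebra.comul (R := k) h with
      | zero => simp
      | tmul a b =>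
        simp only [pair_tmul, LinearMap.comp_apply, LinearMap.mulRight_apply,
          AlgHom.toLinearMap_apply, mul_assoc]
        rw [← mul_assoc (G y), (hG y b).eq, mul_assoc]
      | add _ _ h1 h2 => simp only [map_add, add_mul, h1, h2]
  intro h s
  have e1 : (comulR E F G hr hc hE).toLinearMap ∘ₗ actOn H s =
      pair E.toLinearMap (phi G F hc).toLinearMap ∘ₗ LinearMap.applyₗ (Coalgebra.comul (R := k) s) ∘ₗ
        (act (k := k) (H := H) (V := R ⊗[k] R)).toLinearMap := by
    ext x; exact comul_act _ _ x s
  rw [e1]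
  change _ * pair E.toLinearMap (phi G F hc).toLinearMap (Coalgebra.comul s) = _
  induction Coalgebra.comul (R := k) s with
  | zero => simp [pair_zero_left]
  | add _ _ h1 h2 =>
    simp only [map_add, mul_add, LinearMap.add_comp, LinearMap.comp_add, pair_add_left,
      LinearMap.add_apply, h1, h2]
  | tmul s t =>
    have e2 : pair E.toLinearMap (phi G F hc).toLinearMap ∘ₗ LinearMap.applyₗ (s ⊗ₜ t) ∘ₗ
        (act (k := k) (H := H) (V := R ⊗[k] R)).toLinearMap =
        pair (E.toLinearMap ∘ₗ actOn H s) ((phi G F hc).toLinearMap ∘ₗ actOn H t) ∘ₗ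
          Coalgebra.comul := by
      ext x; exact pair_act_tmul _ _ x s t
    rw [e2, ← comul_assoc_pair]
    have e3 : pair ((phi G F hc).toLinearMap ∘ₗ actOn H t) (comulH G G' hG).toLinearMap ∘ₗ
        Coalgebra.comul = LinearMap.mulRight k (phi G F hc t) ∘ₗ (comulH G G' hG).toLinearMap := by
      ext x; exact s2 x t
    rw [e3, ← pair_mul, s1, pair_tmul, mul_assoc]
    rfl

end lift

section coalgebra

variable (k H R) in
/-- The smash coproduct on `R # H`. -/
def bosonComul : Bosonization k H R →ₗ[k] Bosonization k H R ⊗[k] Bosonization k H R :=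
  TensorProduct.map (Bosonization.of k H R).toLinearMap (Bosonization.of k H R).toLinearMap ∘ₗ
    smashComul k H R ∘ₗ (Bosonization.of k H R).symm.toLinearMap

variable (k H R) in
/-- The counit of `R # H`. -/
def bosonCounit : Bosonization k H R →ₗ[k] k :=
  smashCounit k H R ∘ₗ (Bosonization.of k H R).symm.toLinearMap

theorem smashRel_comp {B : Type*} [Semiring B] [Algebra k B] (F : Bosonization k H R →ₐ[k] B) :
    SmashRel (F.comp (inR k H R)) (F.comp (inH k H R)) := by
  intro h s
  simp only [AlgHom.comp_apply]
  rw [← map_mul, inH_mul_inR, map_pair]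
  rfl

theorem commute_incl (a b : Bosonization k H R) :
    Commute ((Algebra.TensorProduct.includeLeft : Bosonization k H R →ₐ[k] Bosonization k H R ⊗[k] Bosonization k H R) a)
      ((Algebra.TensorProduct.includeRight : Bosonization k H R →ₐ[k] Bosonization k H R ⊗[k] Bosonization k H R) b) := by
  simp [Commute, SemiconjBy]

theorem commute_comp {B : Type*} [Semiring B] [Algebra k B] (P : Bosonization k H R ⊗[k] Bosonization k H R →ₐ[k] B) (a b : Bosonization k H R) :
    Commute ((P.comp (Algebra.TensorProduct.includeLeft : Bosonization k H R →ₐ[k] Bosonization k H R ⊗[k] Bosonization k H R)) a)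
      ((P.comp (Algebra.TensorProduct.includeRight : Bosonization k H R →ₐ[k] Bosonization k H R ⊗[k] Bosonization k H R)) b) :=
  (commute_incl a b).map P

/-- Given two algebra maps `A → B` with commuting images, the algebra map on `A` that is the
composite of `A → A ⊗ A → B`. -/
def comulTo {B : Type*} [Semiring B] [Algebra k B] (e1 e2 : Bosonization k H R →ₐ[k] B)
    (hc : ∀ a b, Commute (e1 a) (e2 b)) : Bosonization k H R →ₐ[k] B :=
  bosonLift
    (comulR (e1.comp (inR k H R)) (e2.comp (inR k H R)) (e1.comp (inH k H R)) (smashRel_comp e1)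
      (fun _ _ => hc _ _) (fun _ _ => hc _ _))
    (comulH (e1.comp (inH k H R)) (e2.comp (inH k H R)) (fun _ _ => hc _ _))
    (smashRel_comul _ _ _ _ _ (smashRel_comp e2) _ _ _ (fun _ _ => hc _ _))

theorem comulTo_inR {B : Type*} [Semiring B] [Algebra k B] (e1 e2 : Bosonization k H R →ₐ[k] B)
    (hc : ∀ a b, Commute (e1 a) (e2 b)) (r : R) :
    comulTo e1 e2 hc (inR k H R r) = pair (e1.comp (inR k H R)).toLinearMap
      (pair (e1.comp (inH k H R)).toLinearMap (e2.comp (inR k H R)).toLinearMap ∘ₗ coact)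
      (Coalgebra.comul r) :=
  bosonLift_inR _ _ _ r

theorem comulTo_inH {B : Type*} [Semiring B] [Algebra k B] (e1 e2 : Bosonization k H R →ₐ[k] B)
    (hc : ∀ a b, Commute (e1 a) (e2 b)) (h : H) :
    comulTo e1 e2 hc (inH k H R h) = pair (e1.comp (inH k H R)).toLinearMap
      (e2.comp (inH k H R)).toLinearMap (Coalgebra.comul h) :=
  (bosonLift_inH _ _ _ h).trans (comulH_apply _ _ _ h)

theorem comp_comulTo {B B' : Type*} [Semiring B] [Algebra k B] [Semiring B'] [Algebra k B']
    (e1 e2 : Bosonization k H R →ₐ[k] B) (hc : ∀ a b, Commute (e1 a) (e2 b)) (P : B →ₐ[k] B')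
    (hc' : ∀ a b, Commute ((P.comp e1) a) ((P.comp e2) b)) :
    P.comp (comulTo e1 e2 hc) = comulTo (P.comp e1) (P.comp e2) hc' := by
  apply boson_algHom_ext
  · intro r
    rw [AlgHom.comp_apply, comulTo_inR, comulTo_inR, map_pair]
    congr 2
    ext x
    exact map_pair P _ _ _
  · intro r
    rw [AlgHom.comp_apply, comulTo_inH, comulTo_inH, map_pair]
    rfl

variable (k H R) in
/-- The comultiplication of `R # H` as an algebra map. -/
def bosonComulAlg : Bosonization k H R →ₐ[k] Bosonization k H R ⊗[k] Bosonization k H R :=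
  comulTo Algebra.TensorProduct.includeLeft Algebra.TensorProduct.includeRight commute_incl

theorem bosonComulAlg_toLinearMap : (bosonComulAlg k H R).toLinearMap = bosonComul k H R := by
  apply boson_ext
  intro r h
  rw [AlgHom.toLinearMap_apply, map_mul, bosonComulAlg, comulTo_inR, comulTo_inH, inR_mul_inH]
  simp only [bosonComul, smashComul, LinearMap.comp_apply, LinearEquiv.coe_coe,
    LinearEquiv.symm_apply_apply, TensorProduct.map_tmul]
  induction Coalgebra.comul (R := k) r with
  | zero => simp
  | add _ _ h1 h2 => simp only [TensorProduct.add_tmul, map_add, add_mul, h1, h2]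
  | tmul s t =>
    induction Coalgebra.comul (R := k) h with
    | zero => simp
    | add _ _ h1 h2 => simp only [TensorProduct.tmul_add, map_add, mul_add, h1, h2]
    | tmul a b =>
      simp only [pair_tmul, LinearMap.comp_apply, LinearMap.rTensor_tmul, LinearMap.lTensor_tmul]
      induction coact (k := k) (H := H) t with
      | zero => simp
      | add _ _ h1 h2 =>
        simp only [TensorProduct.tmul_add, TensorProduct.add_tmul, map_add, mul_add, add_mul,
          h1, h2]
      | tmul x u =>
        simp [mul_assoc, ← inR_mul_inH]

theorem counit_act (h : H) (s : R) : Coalgebra.counit (R := k) (act (k := k) h s) =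
    Coalgebra.counit (R := k) h * Coalgebra.counit (R := k) s := by
  rw [(BraidedHopfAlgebra.counit_hom (k := k) (H := H) (R := R)).1 h s]
  change algebraMap k (Module.End k k) (Coalgebra.counit (R := k) h) _ = _
  simp

variable (k H R) in
/-- The counit of `R` as an algebra map. -/
def counitR : R →ₐ[k] k :=
  AlgHom.ofLinearMap Coalgebra.counit (BraidedHopfAlgebra.counit_one (H := H))
    (BraidedHopfAlgebra.counit_mul (H := H))

variable (k H R) in
/-- The counit of `R # H` as an algebra map. -/
def bosonCounitAlg : Bosonization k H R →ₐ[k] k :=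
  bosonLift (counitR k H R) (Bialgebra.counitAlgHom k H) (by
    intro h s
    have : (counitR k H R).toLinearMap ∘ₗ actOn H s =
        epsMap k (Coalgebra.counit (R := k) s) := by
      ext x
      exact counit_act x s
    rw [this, pair_eps_left, mul_comm]
    rfl)

theorem bosonCounitAlg_toLinearMap : (bosonCounitAlg k H R).toLinearMap = bosonCounit k H R := rfl

theorem bosonCounitAlg_inR (r : R) :
    bosonCounitAlg k H R (inR k H R r) = Coalgebra.counit (R := k) r := bosonLift_inR _ _ _ r

theorem bosonCounitAlg_inH (h : H) :
    bosonCounitAlg k H R (inH k H R h) = Coalgebra.counit (R := k) h := bosonLift_inH _ _ _ h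

theorem comulTo_inH_lin {B : Type*} [Semiring B] [Algebra k B] (e e' : Bosonization k H R →ₐ[k] B)
    (c : ∀ a b, Commute (e a) (e' b)) :
    ((comulTo e e' c).comp (inH k H R)).toLinearMap =
      pair (e.comp (inH k H R)).toLinearMap (e'.comp (inH k H R)).toLinearMap ∘ₗ
        Coalgebra.comul := LinearMap.ext fun x => comulTo_inH e e' c x

theorem comulTo_inR_lin {B : Type*} [Semiring B] [Algebra k B] (e e' : Bosonization k H R →ₐ[k] B)
    (c : ∀ a b, Commute (e a) (e' b)) :
    ((comulTo e e' c).comp (inR k H R)).toLinearMap =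
      pair (e.comp (inR k H R)).toLinearMap
        (pair (e.comp (inH k H R)).toLinearMap (e'.comp (inR k H R)).toLinearMap ∘ₗ coact) ∘ₗ
        Coalgebra.comul := LinearMap.ext fun x => comulTo_inR e e' c x

theorem comulTo_assoc {B : Type*} [Semiring B] [Algebra k B] (e1 e2 e3 : Bosonization k H R →ₐ[k] B)
    (c12 : ∀ a b, Commute (e1 a) (e2 b)) (c23 : ∀ a b, Commute (e2 a) (e3 b))
    (c : ∀ a b, Commute (comulTo e1 e2 c12 a) (e3 b))
    (c' : ∀ a b, Commute (e1 a) (comulTo e2 e3 c23 b)) :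
    comulTo (comulTo e1 e2 c12) e3 c = comulTo e1 (comulTo e2 e3 c23) c' := by
  apply boson_algHom_ext
  · intro r
    rw [comulTo_inR, comulTo_inR, comulTo_inR_lin, comulTo_inR_lin, comulTo_inH_lin,
      ← comul_assoc_pair]
    congr 2
    ext s
    have a1 : pair (pair (e1.comp (inH k H R)).toLinearMap (e2.comp (inH k H R)).toLinearMap ∘ₗ
        Coalgebra.comul) (e3.comp (inR k H R)).toLinearMap ∘ₗ coact =
        pair (e1.comp (inH k H R)).toLinearMap (pair (e2.comp (inH k H R)).toLinearMap
          (e3.comp (inR k H R)).toLinearMap ∘ₗ coact) ∘ₗ coact := by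
      ext x; exact (coact_assoc_pair _ _ _ x).symm
    rw [a1]
    exact (coact_pair_comul (e1.comp (inH k H R)) _ _ (fun x r => c12 _ _) s).symm
  · intro h
    rw [comulTo_inH, comulTo_inH, comulTo_inH_lin, comulTo_inH_lin, ← comul_assoc_pair]

theorem comulTo_counit_left {B : Type*} [Semiring B] [Algebra k B] (e1 e2 : Bosonization k H R →ₐ[k] B)
    (c : ∀ a b, Commute (e1 a) (e2 b))
    (h1 : ∀ a, e1 a = algebraMap k B (bosonCounitAlg k H R a)) : comulTo e1 e2 c = e2 := by
  have hR : (e1.comp (inR k H R)).toLinearMap = epsMap k 1 := by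
    ext x; simp [h1, bosonCounitAlg_inR, Algebra.algebraMap_eq_smul_one]
  have hH : (e1.comp (inH k H R)).toLinearMap = epsMap k 1 := by
    ext x; simp [h1, bosonCounitAlg_inH, Algebra.algebraMap_eq_smul_one]
  apply boson_algHom_ext
  · intro r
    rw [comulTo_inR, hR, hH, pair_eps_left, one_mul, LinearMap.comp_apply, pair_eps_coact, one_mul]
    rfl
  · intro h
    rw [comulTo_inH, hH, pair_eps_left, one_mul]
    rfl

theorem comulTo_counit_right {B : Type*} [Semiring B] [Algebra k B] (e1 e2 : Bosonization k H R →ₐ[k] B)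
    (c : ∀ a b, Commute (e1 a) (e2 b))
    (h1 : ∀ a, e2 a = algebraMap k B (bosonCounitAlg k H R a)) : comulTo e1 e2 c = e1 := by
  have hR : (e2.comp (inR k H R)).toLinearMap = epsMap k 1 := by
    ext x; simp [h1, bosonCounitAlg_inR, Algebra.algebraMap_eq_smul_one]
  have hH : (e2.comp (inH k H R)).toLinearMap = epsMap k 1 := by
    ext x; simp [h1, bosonCounitAlg_inH, Algebra.algebraMap_eq_smul_one]
  apply boson_algHom_ext
  · intro r
    have h3 : pair (e1.comp (inH k H R)).toLinearMap
        (epsMap k 1) ∘ₗ coact (k := k) (H := H) (V := R) = epsMap k 1 := by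
      ext x
      rw [LinearMap.comp_apply, coact_counit_pair]
      simp
    rw [comulTo_inR, hR, h3, pair_eps_right, mul_one]
    rfl
  · intro h
    rw [comulTo_inH, hH, pair_eps_right, mul_one]
    rfl

theorem comp_bosonComulAlg {B : Type*} [Semiring B] [Algebra k B] (P : Bosonization k H R ⊗[k] Bosonization k H R →ₐ[k] B)
    (e1 e2 : Bosonization k H R →ₐ[k] B) (h1 : ∀ a, P (a ⊗ₜ 1) = e1 a) (h2 : ∀ a, P (1 ⊗ₜ a) = e2 a) :
    ∃ c : ∀ a b, Commute (e1 a) (e2 b), P.comp (bosonComulAlg k H R) = comulTo e1 e2 c := by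
  obtain rfl : P.comp Algebra.TensorProduct.includeLeft = e1 := AlgHom.ext h1
  obtain rfl : P.comp Algebra.TensorProduct.includeRight = e2 := AlgHom.ext h2
  exact ⟨commute_comp P, comp_comulTo _ _ _ _ _⟩

theorem boson_coassoc :
    (Algebra.TensorProduct.assoc k k k (Bosonization k H R) (Bosonization k H R) (Bosonization k H R)).toAlgHom.comp
      ((Algebra.TensorProduct.map (bosonComulAlg k H R) (.id k (Bosonization k H R))).comp (bosonComulAlg k H R))
      = (Algebra.TensorProduct.map (.id k (Bosonization k H R)) (bosonComulAlg k H R)).comp (bosonComulAlg k H R) := by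
  let e1 : Bosonization k H R →ₐ[k] Bosonization k H R ⊗[k] (Bosonization k H R ⊗[k] Bosonization k H R) := Algebra.TensorProduct.includeLeft
  let Q : Bosonization k H R ⊗[k] Bosonization k H R →ₐ[k] Bosonization k H R ⊗[k] (Bosonization k H R ⊗[k] Bosonization k H R) := Algebra.TensorProduct.includeRight
  let P : Bosonization k H R ⊗[k] Bosonization k H R →ₐ[k] Bosonization k H R ⊗[k] (Bosonization k H R ⊗[k] Bosonization k H R) :=
    (Algebra.TensorProduct.assoc k k k (Bosonization k H R) (Bosonization k H R) (Bosonization k H R)).toAlgHom.comp Algebra.TensorProduct.includeLeft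
  let e2 : Bosonization k H R →ₐ[k] Bosonization k H R ⊗[k] (Bosonization k H R ⊗[k] Bosonization k H R) := Q.comp Algebra.TensorProduct.includeLeft
  let e3 : Bosonization k H R →ₐ[k] Bosonization k H R ⊗[k] (Bosonization k H R ⊗[k] Bosonization k H R) := Q.comp Algebra.TensorProduct.includeRight
  obtain ⟨c12, hP⟩ := comp_bosonComulAlg P e1 e2 (fun a => rfl) (fun a => rfl)
  obtain ⟨c23, hQ⟩ := comp_bosonComulAlg Q e2 e3 (fun a => rfl) (fun a => rfl)
  obtain ⟨c, hL⟩ := comp_bosonComulAlg ((Algebra.TensorProduct.assoc k k k (Bosonization k H R) (Bosonization k H R) (Bosonization k H R)).toAlgHom.comp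
    (Algebra.TensorProduct.map (bosonComulAlg k H R) (.id k (Bosonization k H R)))) (comulTo e1 e2 c12) e3
    (fun a => by rw [← hP]; simp [P]) (fun a => by simp [e3, Q, Algebra.TensorProduct.one_def])
  obtain ⟨c', hR⟩ := comp_bosonComulAlg
    (Algebra.TensorProduct.map (.id k (Bosonization k H R)) (bosonComulAlg k H R)) e1 (comulTo e2 e3 c23)
    (fun a => by simp [e1]) (fun a => by rw [← hQ]; simp [Q])
  exact hL.trans ((comulTo_assoc e1 e2 e3 c12 c23 c c').trans hR.symm)

theorem boson_rTensor :
    (Algebra.TensorProduct.map (bosonCounitAlg k H R) (.id k (Bosonization k H R))).comp (bosonComulAlg k H R) =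
      (Algebra.TensorProduct.lid k (Bosonization k H R)).symm := by
  obtain ⟨c, h⟩ := comp_bosonComulAlg
    (Algebra.TensorProduct.map (bosonCounitAlg k H R) (.id k (Bosonization k H R)))
    ((Algebra.ofId k (k ⊗[k] Bosonization k H R)).comp (bosonCounitAlg k H R)) Algebra.TensorProduct.includeRight
    (fun a => rfl) (fun a => by simp)
  exact h.trans ((comulTo_counit_left _ _ c (fun a => rfl)).trans rfl)

theorem boson_lTensor :
    (Algebra.TensorProduct.map (.id k (Bosonization k H R)) (bosonCounitAlg k H R)).comp (bosonComulAlg k H R) =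
      (Algebra.TensorProduct.rid k k (Bosonization k H R)).symm := by
  obtain ⟨c, h⟩ := comp_bosonComulAlg
    (Algebra.TensorProduct.map (.id k (Bosonization k H R)) (bosonCounitAlg k H R))
    Algebra.TensorProduct.includeLeft ((Algebra.ofId k (Bosonization k H R ⊗[k] k)).comp (bosonCounitAlg k H R))
    (fun a => by simp)
    (fun a => by simp [Algebra.ofId_apply, Algebra.algebraMap_eq_smul_one,
      Algebra.TensorProduct.one_def, ← TensorProduct.tmul_smul])
  exact h.trans ((comulTo_counit_right _ _ c (fun a => rfl)).trans rfl)

instance : Coalgebra k (Bosonization k H R) where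
  comul := bosonComul k H R
  counit := bosonCounit k H R
  coassoc := by
    rw [← bosonComulAlg_toLinearMap]
    exact congrArg AlgHom.toLinearMap boson_coassoc
  rTensor_counit_comp_comul := by
    rw [← bosonComulAlg_toLinearMap, ← bosonCounitAlg_toLinearMap]
    exact congrArg AlgHom.toLinearMap boson_rTensor
  lTensor_counit_comp_comul := by
    rw [← bosonComulAlg_toLinearMap, ← bosonCounitAlg_toLinearMap]
    exact congrArg AlgHom.toLinearMap boson_lTensor

theorem comul_eq (x : Bosonization k H R) : Coalgebra.comul (R := k) x = bosonComulAlg k H R x :=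
  (LinearMap.congr_fun bosonComulAlg_toLinearMap x).symm

theorem counit_eq (x : Bosonization k H R) : Coalgebra.counit (R := k) x = bosonCounitAlg k H R x := rfl

instance : Bialgebra k (Bosonization k H R) :=
  Bialgebra.mk' k (Bosonization k H R) (map_one (bosonCounitAlg k H R)) (map_mul (bosonCounitAlg k H R) _ _)
    (by rw [comul_eq, map_one]) (by intro a b; rw [comul_eq, comul_eq, comul_eq, map_mul])

variable (k H R) in
/-- The map `r ↦ (1 # S(r₋₁))(S_R(r₀) # 1)`. -/
def antipodeR : R →ₗ[k] Bosonization k H R :=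
  pair ((inH k H R).toLinearMap ∘ₗ HopfAlgebra.antipode k)
    ((inR k H R).toLinearMap ∘ₗ BraidedHopfAlgebra.antipode (k := k) (H := H)) ∘ₗ coact

variable (k H R) in
/-- The antipode `S(r # h) = (1 # S(r₋₁ h))(S_R(r₀) # 1)` of `R # H`, with
`S(r₋₁ h) = S(h) S(r₋₁)`. -/
def bosonAntipode : Bosonization k H R →ₗ[k] Bosonization k H R :=
  pair ((inH k H R).toLinearMap ∘ₗ HopfAlgebra.antipode k) (antipodeR k H R) ∘ₗ
    (TensorProduct.comm k R H).toLinearMap ∘ₗ (Bosonization.of k H R).symm.toLinearMap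

theorem bosonAntipode_mul (r : R) (h : H) :
    bosonAntipode k H R (inR k H R r * inH k H R h) =
      inH k H R (HopfAlgebra.antipode k h) * antipodeR k H R r := by
  simp [bosonAntipode, inR_mul_inH]

theorem bosonAntipode_inR (r : R) :
    bosonAntipode k H R (inR k H R r) = antipodeR k H R r := by
  simpa using bosonAntipode_mul (k := k) (H := H) r 1

theorem bosonAntipode_mul_inH (x : Bosonization k H R) (h : H) :
    bosonAntipode k H R (x * inH k H R h) =
      inH k H R (HopfAlgebra.antipode k h) * bosonAntipode k H R x := by
  have : bosonAntipode k H R ∘ₗ LinearMap.mulRight k (inH k H R h) =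
      LinearMap.mulLeft k (inH k H R (HopfAlgebra.antipode k h)) ∘ₗ bosonAntipode k H R := by
    apply boson_ext
    intro r a
    simp only [LinearMap.comp_apply, LinearMap.mulRight_apply, LinearMap.mulLeft_apply]
    rw [mul_assoc, ← map_mul, bosonAntipode_mul, bosonAntipode_mul,
      HopfAlgebra.antipode_mul_antidistrib, map_mul, mul_assoc]
  exact LinearMap.congr_fun this x

theorem pair_braided_antipode_left {B : Type*} [Semiring B] [Algebra k B] (f : R →ₐ[k] B) (r : R) :
    pair (f.toLinearMap ∘ₗ BraidedHopfAlgebra.antipode (k := k) (H := H)) f.toLinearMap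
      (Coalgebra.comul (R := k) r) = Coalgebra.counit (R := k) r • 1 := by
  have := congrArg f (LinearMap.congr_fun
    (BraidedHopfAlgebra.mul_antipode_rTensor_comul (k := k) (H := H) (R := R)) r)
  simp only [LinearMap.comp_apply, Algebra.linearMap_apply] at this
  rw [AlgHom.commutes, Algebra.algebraMap_eq_smul_one] at this
  rw [← this]
  induction Coalgebra.comul (R := k) r with
  | zero => simp
  | tmul a b => simp
  | add _ _ h1 h2 => simp only [map_add, h1, h2]

theorem pair_braided_antipode_right {B : Type*} [Semiring B] [Algebra k B] (f : R →ₐ[k] B)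
    (r : R) :
    pair f.toLinearMap (f.toLinearMap ∘ₗ BraidedHopfAlgebra.antipode (k := k) (H := H))
      (Coalgebra.comul (R := k) r) = Coalgebra.counit (R := k) r • 1 := by
  have := congrArg f (LinearMap.congr_fun
    (BraidedHopfAlgebra.mul_antipode_lTensor_comul (k := k) (H := H) (R := R)) r)
  simp only [LinearMap.comp_apply, Algebra.linearMap_apply] at this
  rw [AlgHom.commutes, Algebra.algebraMap_eq_smul_one] at this
  rw [← this]
  induction Coalgebra.comul (R := k) r with
  | zero => simp
  | tmul a b => simp
  | add _ _ h1 h2 => simp only [map_add, h1, h2]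

theorem comul_inR_mul_inH (r : R) (h : H) :
    Coalgebra.comul (R := k) (inR k H R r * inH k H R h) =
      Coalgebra.comul (R := k) (inR k H R r) *
        pair (Algebra.TensorProduct.includeLeft.comp (inH k H R)).toLinearMap
          (Algebra.TensorProduct.includeRight.comp (inH k H R)).toLinearMap
          (Coalgebra.comul (R := k) h) := by
  rw [comul_eq, comul_eq, map_mul, bosonComulAlg, comulTo_inH]

theorem comul_inR (r : R) :
    Coalgebra.comul (R := k) (inR k H R r) =
      pair (Algebra.TensorProduct.includeLeft.comp (inR k H R)).toLinearMap
        (pair (Algebra.TensorProduct.includeLeft.comp (inH k H R)).toLinearMap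
          (Algebra.TensorProduct.includeRight.comp (inR k H R)).toLinearMap ∘ₗ coact)
        (Coalgebra.comul (R := k) r) := by
  rw [comul_eq, bosonComulAlg, comulTo_inR]

theorem bosonAntipode_left_inR (r : R) :
    pair (bosonAntipode k H R) LinearMap.id (Coalgebra.comul (R := k) (inR k H R r)) =
      Coalgebra.counit (R := k) r • 1 := by
  have key : ∀ X : R ⊗[k] R, pair (bosonAntipode k H R) LinearMap.id
      (pair (Algebra.TensorProduct.includeLeft.comp (inR k H R)).toLinearMap
        (pair (Algebra.TensorProduct.includeLeft.comp (inH k H R)).toLinearMap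
          (Algebra.TensorProduct.includeRight.comp (inR k H R)).toLinearMap ∘ₗ coact) X) =
      pair ((inH k H R).toLinearMap ∘ₗ HopfAlgebra.antipode k)
        (pair ((inR k H R).toLinearMap ∘ₗ BraidedHopfAlgebra.antipode (k := k) (H := H))
          (inR k H R).toLinearMap) (coact X) := by
    intro X
    induction X with
    | zero => simp
    | add _ _ h1 h2 => simp only [map_add, h1, h2]
    | tmul s t =>
      change _ = pair _ _ ((LinearMap.mul' k H).rTensor (R ⊗[k] R)
        (TensorProduct.tensorTensorTensorComm k H R H R (coact s ⊗ₜ coact t)))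
      rw [pair_rTensor, pair_tmul, LinearMap.comp_apply]
      induction coact (k := k) (H := H) t with
      | zero => simp
      | add _ _ h1 h2 => simp only [TensorProduct.tmul_add, map_add, mul_add, h1, h2]
      | tmul y w =>
        have e : (Algebra.TensorProduct.includeLeft.comp (inR k H R)).toLinearMap s *
            pair (Algebra.TensorProduct.includeLeft.comp (inH k H R)).toLinearMap
              (Algebra.TensorProduct.includeRight.comp (inR k H R)).toLinearMap (y ⊗ₜ w) =
            (inR k H R s * inH k H R y) ⊗ₜ[k] inR k H R w := by
          simp
        rw [e, pair_tmul, bosonAntipode_mul, antipodeR, LinearMap.comp_apply]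
        induction coact (k := k) (H := H) s with
        | zero => simp
        | add _ _ h1 h2 =>
          simp only [TensorProduct.add_tmul, map_add, mul_add, add_mul, h1, h2]
        | tmul x u =>
          simp [HopfAlgebra.antipode_mul_antidistrib, mul_assoc]
  have hΔ := LinearMap.congr_fun (BraidedHopfAlgebra.comul_hom (k := k) (H := H) (R := R)).2 r
  simp only [LinearMap.comp_apply] at hΔ
  rw [comul_inR, key, hΔ, pair_lTensor]
  have : pair ((inR k H R).toLinearMap ∘ₗ BraidedHopfAlgebra.antipode (k := k) (H := H))
      (inR k H R).toLinearMap ∘ₗ Coalgebra.comul = epsMap k 1 := by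
    ext x; exact pair_braided_antipode_left (inR k H R) x
  rw [this, coact_counit_pair]
  simp

theorem bosonAntipode_right_inR (r : R) :
    pair LinearMap.id (bosonAntipode k H R) (Coalgebra.comul (R := k) (inR k H R r)) =
      Coalgebra.counit (R := k) r • 1 := by
  have h1 : pair (inH k H R).toLinearMap (antipodeR k H R) ∘ₗ coact =
      (inR k H R).toLinearMap ∘ₗ BraidedHopfAlgebra.antipode (k := k) (H := H) := by
    ext t
    rw [LinearMap.comp_apply, antipodeR, coact_assoc_pair]
    have : pair (inH k H R).toLinearMap ((inH k H R).toLinearMap ∘ₗ HopfAlgebra.antipode k) ∘ₗ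
        Coalgebra.comul = epsMap k 1 := by
      ext x; exact pair_antipode_right (inH k H R) x
    rw [this, pair_eps_coact, one_mul]
  rw [← pair_braided_antipode_right (H := H) (inR k H R) r, ← h1, comul_inR]
  induction Coalgebra.comul (R := k) r with
  | zero => simp
  | add _ _ h1 h2 => simp only [map_add, h1, h2]
  | tmul s t =>
    rw [pair_tmul, pair_tmul, LinearMap.comp_apply, LinearMap.comp_apply]
    induction coact (k := k) (H := H) t with
    | zero => simp
    | add _ _ h1 h2 => simp only [map_add, mul_add, h1, h2]
    | tmul y w =>
      have e : (Algebra.TensorProduct.includeLeft.comp (inR k H R)).toLinearMap s *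
          pair (Algebra.TensorProduct.includeLeft.comp (inH k H R)).toLinearMap
            (Algebra.TensorProduct.includeRight.comp (inR k H R)).toLinearMap (y ⊗ₜ w) =
          (inR k H R s * inH k H R y) ⊗ₜ[k] inR k H R w := by
        simp
      rw [e, pair_tmul, bosonAntipode_inR]
      simp [mul_assoc]

theorem bosonAntipode_left (x : Bosonization k H R) :
    pair (bosonAntipode k H R) LinearMap.id (Coalgebra.comul (R := k) x) =
      Coalgebra.counit (R := k) x • 1 := by
  have : pair (bosonAntipode k H R) LinearMap.id ∘ₗ Coalgebra.comul = epsMap k 1 := by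
    apply boson_ext
    intro r h
    rw [LinearMap.comp_apply, comul_inR_mul_inH]
    have key : ∀ (Z : Bosonization k H R ⊗[k] Bosonization k H R) (c : k), pair (bosonAntipode k H R) LinearMap.id Z = c • 1 →
        ∀ Y : H ⊗[k] H, pair (bosonAntipode k H R) LinearMap.id
          (Z * pair (Algebra.TensorProduct.includeLeft.comp (inH k H R)).toLinearMap
            (Algebra.TensorProduct.includeRight.comp (inH k H R)).toLinearMap Y) =
        c • pair ((inH k H R).toLinearMap ∘ₗ HopfAlgebra.antipode k) (inH k H R).toLinearMap Y := by
      intro Z c hZ Y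
      induction Y with
      | zero => simp
      | add _ _ h1 h2 => simp only [map_add, mul_add, smul_add, h1, h2]
      | tmul a b =>
        have e : ∀ Z : Bosonization k H R ⊗[k] Bosonization k H R, pair (bosonAntipode k H R) LinearMap.id
            (Z * (inH k H R a ⊗ₜ[k] inH k H R b)) =
            inH k H R (HopfAlgebra.antipode k a) *
              pair (bosonAntipode k H R) LinearMap.id Z * inH k H R b := by
          intro Z
          induction Z with
          | zero => simp
          | add _ _ h1 h2 => simp only [map_add, mul_add, add_mul, h1, h2]
          | tmul x y => simp [bosonAntipode_mul_inH, mul_assoc]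
        have e2 : pair (Algebra.TensorProduct.includeLeft.comp (inH k H R)).toLinearMap
            (Algebra.TensorProduct.includeRight.comp (inH k H R)).toLinearMap (a ⊗ₜ[k] b) =
            (inH k H R a ⊗ₜ[k] inH k H R b) := by simp
        rw [e2, e, hZ]
        simp
    rw [key _ _ (bosonAntipode_left_inR r), pair_antipode_left, epsMap_apply, counit_eq, map_mul,
      bosonCounitAlg_inR, bosonCounitAlg_inH, mul_smul]
  exact LinearMap.congr_fun this x

theorem bosonAntipode_right (x : Bosonization k H R) :
    pair LinearMap.id (bosonAntipode k H R) (Coalgebra.comul (R := k) x) =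
      Coalgebra.counit (R := k) x • 1 := by
  have : pair LinearMap.id (bosonAntipode k H R) ∘ₗ Coalgebra.comul = epsMap k 1 := by
    apply boson_ext
    intro r h
    rw [LinearMap.comp_apply, comul_inR_mul_inH]
    have key : ∀ (Z : Bosonization k H R ⊗[k] Bosonization k H R), pair LinearMap.id (bosonAntipode k H R)
          (Z * pair (Algebra.TensorProduct.includeLeft.comp (inH k H R)).toLinearMap
            (Algebra.TensorProduct.includeRight.comp (inH k H R)).toLinearMap
              (Coalgebra.comul (R := k) h)) =
        Coalgebra.counit (R := k) h • pair LinearMap.id (bosonAntipode k H R) Z := by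
      intro Z
      induction Z with
      | zero => simp
      | add _ _ h1 h2 => simp only [map_add, add_mul, smul_add, h1, h2]
      | tmul x y =>
        have e : x * (pair (inH k H R).toLinearMap
            ((inH k H R).toLinearMap ∘ₗ HopfAlgebra.antipode k) (Coalgebra.comul (R := k) h)) *
            bosonAntipode k H R y =
            Coalgebra.counit (R := k) h • pair LinearMap.id (bosonAntipode k H R) (x ⊗ₜ y) := by
          rw [pair_antipode_right]; simp
        rw [← e]
        induction Coalgebra.comul (R := k) h with
        | zero => simp
        | add _ _ h1 h2 => simp only [map_add, add_mul, mul_add, h1, h2]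
        | tmul a b => simp [bosonAntipode_mul_inH, mul_assoc]
    rw [key, bosonAntipode_right_inR, epsMap_apply, counit_eq, map_mul,
      bosonCounitAlg_inR, bosonCounitAlg_inH, mul_smul, smul_comm]
  exact LinearMap.congr_fun this x

/-- The bosonization `R # H` as a Hopf algebra. -/
instance : HopfAlgebra k (Bosonization k H R) where
  antipode := bosonAntipode k H R
  mul_antipode_rTensor_comul := by
    ext x
    exact (bosonAntipode_left x).trans (Algebra.algebraMap_eq_smul_one _).symm
  mul_antipode_lTensor_comul := by
    ext x
    exact (bosonAntipode_right x).trans (Algebra.algebraMap_eq_smul_one _).symm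

end coalgebra

end smash

end Lemmas

section integrals

variable {k : Type u} {C : Type v} [Field k] [Ring C] [Algebra k C] [Coalgebra k C]

/-- A left integral on `C`: `α * I = α(1) I` for all `α ∈ C*`, where `*` is the convolution
product `(α * β)(c) = α(c₁) β(c₂)`. -/
def IsLeftIntegral (I : C →ₗ[k] k) : Prop :=
  ∀ α : C →ₗ[k] k, LinearMap.mul' k k ∘ₗ TensorProduct.map α I ∘ₗ Coalgebra.comul = α 1 • I

/-- A right integral on `C`: `I * α = α(1) I` for all `α ∈ C*`. -/
def IsRightIntegral (I : C →ₗ[k] k) : Prop :=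
  ∀ α : C →ₗ[k] k, LinearMap.mul' k k ∘ₗ TensorProduct.map I α ∘ₗ Coalgebra.comul = α 1 • I

variable (k C) in
/-- `C` (a Hopf algebra or a braided Hopf algebra) is left co-Frobenius if it admits a nonzero
left integral. -/
def IsLeftCoFrobenius : Prop := ∃ I : C →ₗ[k] k, I ≠ 0 ∧ IsLeftIntegral I

variable (k C) in
/-- `C` is right co-Frobenius if it admits a nonzero right integral. -/
def IsRightCoFrobenius : Prop := ∃ I : C →ₗ[k] k, I ≠ 0 ∧ IsRightIntegral I

end integrals
end BraidedHopf
end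

/-! Everything comes from one formula for convolution on `A = R # H`: `(α * β)(r # h) = α(r⁽¹⁾ #
r⁽²⁾₋₁ h₁) β(r⁽²⁾₀ # h₂)`. Integrals on `A` are built from integrals on the two factors. Conversely,
integrals on the factors are recovered by testing an integral on `A` against the functionals `γ ⊗ ε`
and `ε ⊗ φ` and fixing one tensor argument. The only obstruction is the element `r⁽²⁾₋₁` produced by
the coaction.

Right integrals. If `γ` and `φ` are right integrals, so is `γ ⊗ φ`: the integral `γ` replaces `r⁽²⁾`
by `1`, whose coaction is trivial, and `φ` then handles `H` (`isRightIntegral_tensorFunctional`).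
Conversely, for a right integral `I` every slice `I(r # ·)` and `I(· # h)` is a right integral. The
first follows from testing against `ε ⊗ φ`, since `ε` is colinear. Testing against `β ⊗ ε` leaves
`I(r⁽¹⁾ # r⁽²⁾₋₁ h) β(r⁽²⁾₀) = β(1) I(r # h)`. This holds for all `h` and `β`, so it is an identity
in `H* ⊗ R`, in which `h` may be replaced by `S(w₋₁) h` with `w` the second tensor leg; the coaction
term then cancels (`IsRightIntegral.sliceR`).

Left integrals. The slices `I(· # h)` are again left integrals, but those in the `H` direction need
a twist. As the antipode is bijective, `r ⊗ h ↦ r₀ ⊗ r₋₁ h` is a bijection of `R ⊗ H`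
(`coactEquiv`), so `I(r # h) = J(r₀ # r₋₁ h)` for a unique `J`. Coassociativity of the coaction and
multiplicativity of `Δ` turn the integral identity of `I` into the statement that all `J(r # ·)` are
left integrals (`coactPair_twistFunctional`). Conversely, left integrals `γ` and `φ` yield the left
integral `r # h ↦ γ(r₀) φ(r₋₁ h)`. Its verification rests on `r⁽¹⁾ ⊗ γ(r⁽²⁾₀) r⁽²⁾₋₁ = 1 ⊗ γ(r₀)
r₋₁`, a consequence of the colinearity of the coproduct of `R` and the injectivity of the twist
(`IsLeftIntegral.lTensor_coactContract`). -/

noncomputable section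

namespace BraidedHopf

open YDStruct

/-! ### Separating elements of `V* ⊗ W` -/

section separation

variable {k V W : Type*} [Field k] [AddCommGroup V] [Module k V] [AddCommGroup W] [Module k W]

/-- Evaluations on the left and functionals on the right separate the elements of `V* ⊗ W`. -/
theorem dual_tensor_ext {x y : Module.Dual k V ⊗[k] W}
    (h : ∀ (v : V) (β : W →ₗ[k] k),
      pair (LinearMap.applyₗ v) β x = pair (LinearMap.applyₗ v) β y) : x = y := by
  classical
  -- A basis of `W` identifies `V* ⊗ W` with finitely supported families of functionals on `V`; the
  -- coordinate functionals of `W` read off the members of the family.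
  let b := Module.Basis.ofVectorSpace k W
  apply (TensorProduct.equivFinsuppOfBasisRight b).injective
  ext i v
  have key : ∀ z : Module.Dual k V ⊗[k] W,
      TensorProduct.equivFinsuppOfBasisRight b z i v =
        pair (LinearMap.applyₗ v) (b.coord i) z := by
    intro z
    induction z with
    | zero => simp
    | tmul φ w => simp [mul_comm]
    | add _ _ h1 h2 => simp only [map_add, Finsupp.add_apply, LinearMap.add_apply, h1, h2]
  rw [key, key, h]

end separation

/-! ### Integrals as elementwise identities -/

section integrals

variable {k C : Type*} [Field k] [Ring C] [Algebra k C] [Coalgebra k C] {I : C →ₗ[k] k}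

theorem isLeftIntegral_iff :
    IsLeftIntegral I ↔ ∀ (α : C →ₗ[k] k) (c : C), pair α I (Coalgebra.comul c) = α 1 * I c :=
  forall_congr' fun _ => LinearMap.ext_iff

theorem isRightIntegral_iff :
    IsRightIntegral I ↔ ∀ (α : C →ₗ[k] k) (c : C), pair I α (Coalgebra.comul c) = α 1 * I c :=
  forall_congr' fun _ => LinearMap.ext_iff

/-- `f(c₁) I(c₂) = I(c) f(1)` for a left integral `I` and any linear map `f` to an algebra. -/
theorem IsLeftIntegral.pair_toSpanSingleton (hI : IsLeftIntegral I) {B : Type*} [Ring B]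
    [Algebra k B] (f : C →ₗ[k] B) (c : C) :
    pair f (LinearMap.toSpanSingleton k B 1 ∘ₗ I) (Coalgebra.comul c) = I c • f 1 := by
  -- Functionals on `B` separate points, and `φ ∘ f` is a scalar functional to which the defining
  -- identity of `I` applies.
  rw [← sub_eq_zero, ← Module.forall_dual_apply_eq_zero_iff k]
  intro φ
  have key : ∀ X : C ⊗[k] C, φ (pair f (LinearMap.toSpanSingleton k B 1 ∘ₗ I) X) =
      pair (φ ∘ₗ f) I X := by
    intro X
    induction X with
    | zero => simp
    | tmul a b => simp [mul_comm]
    | add _ _ h1 h2 => simp only [map_add, h1, h2]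
  rw [map_sub, key, isLeftIntegral_iff.1 hI]
  simp [mul_comm]

end integrals

/-! ### Identities for the inverse antipode -/

section inverse

variable {k H : Type*} [Field k] [Ring H] [HopfAlgebra k H]
  (hS : Function.Bijective (HopfAlgebra.antipode k : H →ₗ[k] H))

/-- The inverse of a bijective antipode. -/
def antipodeInv : H →ₗ[k] H :=
  (LinearEquiv.ofBijective (HopfAlgebra.antipode k : H →ₗ[k] H) hS).symm.toLinearMap

@[simp]
theorem antipode_antipodeInv (h : H) : HopfAlgebra.antipode k (antipodeInv hS h) = h :=
  (LinearEquiv.ofBijective (HopfAlgebra.antipode k : H →ₗ[k] H) hS).apply_symm_apply h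

/-- `S⁻¹(h₂) h₁ = ε(h) 1`. -/
theorem antipodeInv_mul (h : H) :
    LinearMap.mul' k H (TensorProduct.map (antipodeInv hS) LinearMap.id
      (TensorProduct.comm k H H (Coalgebra.comul h))) = Coalgebra.counit (R := k) h • 1 := by
  -- The antipode is injective and reverses products, so applying it turns `S⁻¹(h₂) h₁` into `S(h₁)
  -- h₂`.
  apply hS.1
  rw [map_smul, HopfAlgebra.antipode_one, ← Algebra.algebraMap_eq_smul_one,
    ← HopfAlgebra.mul_antipode_rTensor_comul_apply (R := k) h]
  induction Coalgebra.comul (R := k) h with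
  | zero => simp
  | tmul a b => simp [HopfAlgebra.antipode_mul_antidistrib]
  | add _ _ h1 h2 => simp only [map_add, h1, h2]

/-- `h₂ S⁻¹(h₁) = ε(h) 1`. -/
theorem mul_antipodeInv (h : H) :
    LinearMap.mul' k H (TensorProduct.map LinearMap.id (antipodeInv hS)
      (TensorProduct.comm k H H (Coalgebra.comul h))) = Coalgebra.counit (R := k) h • 1 := by
  -- Likewise `S(h₂ S⁻¹(h₁)) = h₁ S(h₂)`.
  apply hS.1
  rw [map_smul, HopfAlgebra.antipode_one, ← Algebra.algebraMap_eq_smul_one,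
    ← HopfAlgebra.mul_antipode_lTensor_comul_apply (R := k) h]
  induction Coalgebra.comul (R := k) h with
  | zero => simp
  | tmul a b => simp [HopfAlgebra.antipode_mul_antidistrib]
  | add _ _ h1 h2 => simp only [map_add, h1, h2]

end inverse

/-! ### The twist of `R ⊗ H` by the coaction -/

section coaction

variable {k H R : Type*} [Field k] [Ring H] [HopfAlgebra k H] [Ring R] [Algebra k R]

/-- The map `r ⊗ h ↦ r₀ ⊗ f(r₋₁) h` on `R ⊗ H`. -/
def coactTwist [YDStruct k H R] (f : H →ₗ[k] H) : R ⊗[k] H →ₗ[k] R ⊗[k] H :=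
  pair (pair ((Algebra.TensorProduct.includeRight : H →ₐ[k] R ⊗[k] H).toLinearMap ∘ₗ f)
      (Algebra.TensorProduct.includeLeft : R →ₐ[k] R ⊗[k] H).toLinearMap ∘ₗ coact)
    (Algebra.TensorProduct.includeRight : H →ₐ[k] R ⊗[k] H).toLinearMap

theorem coactTwist_tmul [YDStruct k H R] (f : H →ₗ[k] H) (r : R) (h : H) :
    coactTwist f (r ⊗ₜ[k] h) = TensorProduct.map LinearMap.id (LinearMap.mulRight k h ∘ₗ f)
      (TensorProduct.comm k H R (coact r)) := by
  rw [coactTwist, pair_tmul, LinearMap.comp_apply]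
  induction coact (k := k) (H := H) r with
  | zero => simp
  | tmul a b => simp
  | add _ _ h1 h2 => simp only [map_add, add_mul, h1, h2]

/-- Composing two twists: only `f` and `g` on the two legs of a coproduct matter. -/
theorem coactTwist_coactTwist [YetterDrinfeldModule k H R] (f g : H →ₗ[k] H)
    (hfg : ∀ h : H, LinearMap.mul' k H (TensorProduct.map f g
      (TensorProduct.comm k H H (Coalgebra.comul h))) = Coalgebra.counit (R := k) h • 1)
    (x : R ⊗[k] H) : coactTwist f (coactTwist g x) = x := by
  induction x with
  | zero => simp
  | add _ _ h1 h2 => simp only [map_add, h1, h2]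
  | tmul r h =>
    -- `Φ` sends `z ⊗ (y ⊗ v)` to `v ⊗ f(y) g(z) h`. The double twist is its value on the iterated
    -- coaction of `r`; coassociativity makes `z ⊗ y` a coproduct, and `hfg` collapses `f(y) g(z)`
    -- to a counit.
    let Φ : H ⊗[k] (H ⊗[k] R) →ₗ[k] R ⊗[k] H :=
      TensorProduct.map LinearMap.id (LinearMap.mulRight k h) ∘ₗ
        (TensorProduct.comm k H R).toLinearMap ∘ₗ
        (LinearMap.mul' k H ∘ₗ TensorProduct.map f g ∘ₗ
          (TensorProduct.comm k H H).toLinearMap).rTensor R ∘ₗ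
        (TensorProduct.assoc k H H R).symm.toLinearMap
    have h1 : coactTwist f (coactTwist g (r ⊗ₜ[k] h)) =
        Φ ((coact (k := k) (H := H)).lTensor H (coact r)) := by
      rw [coactTwist_tmul]
      induction coact (k := k) (H := H) r with
      | zero => simp
      | add _ _ h1 h2 => simp only [map_add, h1, h2]
      | tmul z w =>
        simp only [TensorProduct.comm_tmul, TensorProduct.map_tmul, LinearMap.lTensor_tmul,
          LinearMap.id_apply, LinearMap.comp_apply, coactTwist_tmul]
        induction coact (k := k) (H := H) w with
        | zero => simp
        | add _ _ h1 h2 => simp only [map_add, TensorProduct.tmul_add, h1, h2]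
        | tmul y v => simp [Φ, mul_assoc]
    have h2 := LinearMap.congr_fun
      (YetterDrinfeldModule.coact_coassoc (k := k) (H := H) (V := R)) r
    simp only [LinearMap.comp_apply] at h2
    rw [h1, ← h2]
    have h3 : ∀ X : H ⊗[k] R, Φ (TensorProduct.assoc k H H R
        ((Coalgebra.comul (R := k) (A := H)).rTensor R X)) =
        TensorProduct.lid k R ((Coalgebra.counit (R := k) (A := H)).rTensor R X) ⊗ₜ[k] h := by
      intro X
      induction X with
      | zero => simp
      | add _ _ h1 h2 => simp only [map_add, TensorProduct.add_tmul, h1, h2]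
      | tmul z w =>
        simp [Φ, hfg, TensorProduct.smul_tmul]
    have h4 := LinearMap.congr_fun
      (YetterDrinfeldModule.coact_counit (k := k) (H := H) (V := R)) r
    simp only [LinearMap.comp_apply] at h4
    refine (h3 _).trans ?_
    erw [h4]
    simp

variable (R) in
/-- The bijection `r ⊗ h ↦ r₀ ⊗ r₋₁ h` of `R ⊗ H`. -/
def coactEquiv [YetterDrinfeldModule k H R]
    (hS : Function.Bijective (HopfAlgebra.antipode k : H →ₗ[k] H)) :
    R ⊗[k] H ≃ₗ[k] R ⊗[k] H :=
  LinearEquiv.ofLinearMap (coactTwist LinearMap.id) (coactTwist (antipodeInv hS))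
    (LinearMap.ext (coactTwist_coactTwist _ _ (mul_antipodeInv hS)))
    (LinearMap.ext (coactTwist_coactTwist _ _ (antipodeInv_mul hS)))

theorem coactEquiv_tmul [YetterDrinfeldModule k H R]
    (hS : Function.Bijective (HopfAlgebra.antipode k : H →ₗ[k] H)) (r : R) (h : H) :
    coactEquiv R hS (r ⊗ₜ[k] h) = TensorProduct.map LinearMap.id (LinearMap.mulRight k h)
      (TensorProduct.comm k H R (coact r)) :=
  coactTwist_tmul _ r h

end coaction

/-! ### Functionals on `R # H` and their convolution -/

section bosonization

variable {k H R : Type*} [Field k] [Ring H] [HopfAlgebra k H] [Ring R] [Algebra k R]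

/-- The functional `r ↦ β(r # h)` on `R`. -/
def sliceR (β : Bosonization k H R →ₗ[k] k) (h : H) : R →ₗ[k] k :=
  β ∘ₗ (Bosonization.of k H R).toLinearMap ∘ₗ (TensorProduct.mk k R H).flip h

/-- The functional `h ↦ β(r # h)` on `H`. -/
def sliceH (β : Bosonization k H R →ₗ[k] k) (r : R) : H →ₗ[k] k :=
  β ∘ₗ (Bosonization.of k H R).toLinearMap ∘ₗ TensorProduct.mk k R H r

@[simp]
theorem sliceR_apply (β : Bosonization k H R →ₗ[k] k) (h : H) (r : R) :
    sliceR β h r = β (Bosonization.of k H R (r ⊗ₜ h)) := rfl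

@[simp]
theorem sliceH_apply (β : Bosonization k H R →ₗ[k] k) (r : R) (h : H) :
    sliceH β r h = β (Bosonization.of k H R (r ⊗ₜ h)) := rfl

/-- The functional `r # h ↦ γ(r) φ(h)`. -/
def tensorFunctional (γ : R →ₗ[k] k) (φ : H →ₗ[k] k) : Bosonization k H R →ₗ[k] k :=
  pair γ φ ∘ₗ (Bosonization.of k H R).symm.toLinearMap

@[simp]
theorem tensorFunctional_of (γ : R →ₗ[k] k) (φ : H →ₗ[k] k) (x : R ⊗[k] H) :
    tensorFunctional γ φ (Bosonization.of k H R x) = pair γ φ x := rfl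

/-- A nonzero functional on `R # H` is nonzero at some `r # h`. -/
theorem exists_of_tmul_ne_zero {β : Bosonization k H R →ₗ[k] k} (hβ : β ≠ 0) :
    ∃ (r : R) (h : H), β (Bosonization.of k H R (r ⊗ₜ h)) ≠ 0 := by
  by_contra! hc
  apply hβ
  have : β ∘ₗ (Bosonization.of k H R).toLinearMap = 0 := TensorProduct.ext' hc
  ext x
  exact LinearMap.congr_fun this x

section

variable [YDStruct k H R]

/-- The bilinear map `(t, x ⊗ y) ↦ f(t₋₁ x) β(t₀ # y)`. -/
def coactPair (f : H →ₗ[k] k) (β : Bosonization k H R →ₗ[k] k) :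
    R →ₗ[k] H ⊗[k] H →ₗ[k] k :=
  TensorProduct.curry (pair (f ∘ₗ LinearMap.mul' k H) (β ∘ₗ (Bosonization.of k H R).toLinearMap) ∘ₗ
    (TensorProduct.tensorTensorTensorComm k H R H H).toLinearMap) ∘ₗ coact

theorem coactPair_tmul (f : H →ₗ[k] k) (β : Bosonization k H R →ₗ[k] k) (t : R) (x y : H) :
    coactPair f β t (x ⊗ₜ y) =
      pair (f ∘ₗ LinearMap.mulRight k x) (sliceR β y) (coact t) := by
  simp only [coactPair, LinearMap.comp_apply, TensorProduct.curry_apply]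
  induction coact (k := k) (H := H) t with
  | zero => simp
  | tmul z w => simp
  | add _ _ h1 h2 => simp only [map_add, TensorProduct.add_tmul, h1, h2]

theorem coactPair_smul_left (c : k) (f : H →ₗ[k] k) (β : Bosonization k H R →ₗ[k] k) (t : R)
    (Y : H ⊗[k] H) : coactPair (c • f) β t Y = c * coactPair f β t Y := by
  simp only [coactPair, LinearMap.comp_apply, TensorProduct.curry_apply]
  induction TensorProduct.tensorTensorTensorComm k H R H H
    (coact (k := k) (H := H) t ⊗ₜ[k] Y) using TensorProduct.induction_on with
  | zero => simp
  | tmul z w => simp [mul_assoc]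
  | add _ _ h1 h2 => simp_all [map_add, mul_add]

/-- The bilinear map `(s ⊗ t, x ⊗ y) ↦ α(s # t₋₁ x) β(t₀ # y)`. -/
def smashPair (α β : Bosonization k H R →ₗ[k] k) :
    R ⊗[k] R →ₗ[k] H ⊗[k] H →ₗ[k] k :=
  TensorProduct.curry (pair (α ∘ₗ (Bosonization.of k H R).toLinearMap)
      (β ∘ₗ (Bosonization.of k H R).toLinearMap) ∘ₗ
    ((LinearMap.mul' k H).lTensor R ∘ₗ
      (TensorProduct.assoc k R H H).toLinearMap).rTensor (R ⊗[k] H) ∘ₗ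
    (TensorProduct.tensorTensorTensorComm k (R ⊗[k] H) R H H).toLinearMap ∘ₗ
    ((TensorProduct.assoc k R H R).symm.toLinearMap ∘ₗ
      (coact (k := k) (H := H) (V := R)).lTensor R).rTensor (H ⊗[k] H))

theorem smashPair_tmul (α β : Bosonization k H R →ₗ[k] k) (s t : R)
    (Y : H ⊗[k] H) : smashPair α β (s ⊗ₜ t) Y = coactPair (sliceH α s) β t Y := by
  simp only [smashPair, coactPair, LinearMap.comp_apply, TensorProduct.curry_apply,
    LinearMap.rTensor_tmul, LinearMap.lTensor_tmul]
  induction coact (k := k) (H := H) t with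
  | zero => simp
  | add _ _ h1 h2 => simp only [map_add, TensorProduct.add_tmul, TensorProduct.tmul_add, h1, h2]
  | tmul z w =>
    induction Y with
    | zero => simp
    | add _ _ h1 h2 => simp only [map_add, TensorProduct.tmul_add, h1, h2]
    | tmul x y => simp

end

variable [Coalgebra k R] [BraidedHopfAlgebra k H R]

/-- This separates the coproduct of `R` from that of `H`. Later arguments can replace either one by
an arbitrary tensor and reason by linearity, while using the coalgebra axioms of the other. -/
theorem pair_comul_of (α β : Bosonization k H R →ₗ[k] k) (r : R) (h : H) :
    pair α β (Coalgebra.comul (Bosonization.of k H R (r ⊗ₜ h))) =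
      smashPair α β (Coalgebra.comul r) (Coalgebra.comul h) := by
  change pair α β (TensorProduct.map _ _ (smashComul k H R (r ⊗ₜ h))) = _
  rw [pair_map]
  rfl

theorem one_eq_of : (1 : Bosonization k H R) = Bosonization.of k H R (1 ⊗ₜ 1) := rfl

theorem isLeftIntegral_boson_iff {I : Bosonization k H R →ₗ[k] k} :
    IsLeftIntegral I ↔ ∀ (α : Bosonization k H R →ₗ[k] k) (r : R) (h : H),
      smashPair α I (Coalgebra.comul r) (Coalgebra.comul h) =
        α 1 * I (Bosonization.of k H R (r ⊗ₜ h)) := by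
  rw [isLeftIntegral_iff]
  refine forall_congr' fun α => ⟨fun hI r h => by rw [← pair_comul_of, hI], fun hI => ?_⟩
  have : pair α I ∘ₗ Coalgebra.comul = α 1 • I := by
    apply boson_ext
    intro r h
    rw [inR_mul_inH, LinearMap.comp_apply, pair_comul_of, hI]
    rfl
  exact LinearMap.congr_fun this

theorem isRightIntegral_boson_iff {I : Bosonization k H R →ₗ[k] k} :
    IsRightIntegral I ↔ ∀ (α : Bosonization k H R →ₗ[k] k) (r : R) (h : H),
      smashPair I α (Coalgebra.comul r) (Coalgebra.comul h) =
        α 1 * I (Bosonization.of k H R (r ⊗ₜ h)) := by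
  rw [isRightIntegral_iff]
  refine forall_congr' fun α => ⟨fun hI r h => by rw [← pair_comul_of, hI], fun hI => ?_⟩
  have : pair I α ∘ₗ Coalgebra.comul = α 1 • I := by
    apply boson_ext
    intro r h
    rw [inR_mul_inH, LinearMap.comp_apply, pair_comul_of, hI]
    rfl
  exact LinearMap.congr_fun this

/-- The coaction of `1` is `1 ⊗ 1`. This is the case reached once a right integral on `R` has
replaced the second leg of a coproduct by `1`. -/
theorem coactPair_one (f : H →ₗ[k] k) (β : Bosonization k H R →ₗ[k] k) (Y : H ⊗[k] H) :
    coactPair f β 1 Y = pair f (sliceH β 1) Y := by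
  induction Y with
  | zero => simp
  | add _ _ h1 h2 => simp only [map_add, h1, h2]
  | tmul x y => simp [coactPair_tmul, coact_one]

/-- Colinearity of the counit of `R` gives `t₋₁ ε(t₀) = ε(t) 1`, so the coaction disappears. -/
theorem coactPair_tensor_counit_left (f φ : H →ₗ[k] k) (t : R) (Y : H ⊗[k] H) :
    coactPair f (tensorFunctional Coalgebra.counit φ) t Y =
      Coalgebra.counit (R := k) t * pair f φ Y := by
  induction Y with
  | zero => simp
  | add _ _ h1 h2 => simp only [map_add, mul_add, h1, h2]
  | tmul x y =>
    have : sliceR (tensorFunctional Coalgebra.counit φ) y = epsMap (C := R) k (φ y) := by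
      ext; simp
    rw [coactPair_tmul, this, coact_counit_pair]
    simp

/-- The counit of `H` removes `h₂`, but the factor `t₋₁` survives inside `f`; this is the term that
`IsRightIntegral.sliceR` has to cancel. -/
theorem coactPair_tensor_counit_right (f : H →ₗ[k] k) (γ : R →ₗ[k] k) (t : R) (h : H) :
    coactPair f (tensorFunctional γ Coalgebra.counit) t (Coalgebra.comul h) =
      pair (f ∘ₗ LinearMap.mulRight k h) γ (coact t) := by
  -- For a general tensor `Y`, the role of `h` is played by `(id ⊗ ε)(Y)`, so both sides are linear
  -- in `Y`.
  have key : ∀ Y : H ⊗[k] H, coactPair f (tensorFunctional γ Coalgebra.counit) t Y =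
      pair (f ∘ₗ LinearMap.mulRight k (TensorProduct.rid k H
        ((Coalgebra.counit (R := k) (A := H)).lTensor H Y))) γ (coact t) := by
    intro Y
    induction Y with
    | zero => simp [pair_zero_left]
    | add _ _ h1 h2 =>
      have hadd : ∀ a b : H, f ∘ₗ LinearMap.mulRight k (a + b) =
          f ∘ₗ LinearMap.mulRight k a + f ∘ₗ LinearMap.mulRight k b := by
        intro a b; ext; simp [mul_add]
      simp only [map_add, h1, h2, hadd, pair_add_left, LinearMap.add_apply]
    | tmul x y =>
      rw [coactPair_tmul]
      induction coact (k := k) (H := H) t with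
      | zero => simp
      | add _ _ h1 h2 => simp only [map_add, h1, h2]
      | tmul z w => simp; ring
  rw [key, Coalgebra.lTensor_counit_comul]
  simp

/-- Since `ε(t₋₁ h₁) = ε(t₋₁) ε(h₁)`, the counit laws of the coaction and of `H` apply separately.
-/
theorem coactPair_counit (β : Bosonization k H R →ₗ[k] k) (t : R) (h : H) :
    coactPair Coalgebra.counit β t (Coalgebra.comul h) =
      β (Bosonization.of k H R (t ⊗ₜ h)) := by
  have key : ∀ Y : H ⊗[k] H, coactPair Coalgebra.counit β t Y =
      pair (epsMap k 1) (sliceH β t) Y := by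
    intro Y
    induction Y with
    | zero => simp
    | add _ _ h1 h2 => simp only [map_add, h1, h2]
    | tmul x y =>
      have : (Coalgebra.counit (R := k) (A := H)) ∘ₗ LinearMap.mulRight k x =
          epsMap k (Coalgebra.counit (R := k) x) := by
        ext; simp
      rw [coactPair_tmul, this, pair_eps_coact]
      simp
  rw [key, pair_eps_left]
  simp

/-! ### Right integrals -/

section right

/-- The convolution with `α` is `γ(r⁽¹⁾) F(r⁽²⁾)` with `F(t) = φ(t₋₁ h₁) α(t₀ # h₂)`. As `γ` is a
right integral, this equals `γ(r) F(1) = γ(r) φ(h₁) α(1 # h₂)`, and the integral property of `φ`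
finishes. -/
theorem isRightIntegral_tensorFunctional {γ : R →ₗ[k] k} {φ : H →ₗ[k] k}
    (hγ : IsRightIntegral γ) (hφ : IsRightIntegral φ) :
    IsRightIntegral (tensorFunctional γ φ : Bosonization k H R →ₗ[k] k) := by
  rw [isRightIntegral_boson_iff]
  intro α r h
  have key : ∀ (X : R ⊗[k] R) (Y : H ⊗[k] H), smashPair (tensorFunctional γ φ) α X Y =
      pair γ ((coactPair φ α).flip Y) X := by
    intro X Y
    induction X with
    | zero => simp
    | add _ _ h1 h2 => simp only [map_add, LinearMap.add_apply, h1, h2]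
    | tmul s t =>
      have : sliceH (tensorFunctional γ φ : Bosonization k H R →ₗ[k] k) s = γ s • φ := by
        ext; simp
      rw [smashPair_tmul, this, coactPair_smul_left]
      simp
  rw [key, isRightIntegral_iff.1 hγ, LinearMap.flip_apply, coactPair_one,
    isRightIntegral_iff.1 hφ, one_eq_of]
  simp
  ring

/-- Testing `I` against `ε ⊗ φ` reduces the convolution to `I(r # h₁) φ(h₂)`, since the counit of
`R` absorbs both the coaction and the coproduct of `r`. -/
theorem IsRightIntegral.sliceH {I : Bosonization k H R →ₗ[k] k} (hI : IsRightIntegral I)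
    (r : R) : IsRightIntegral (sliceH I r) := by
  rw [isRightIntegral_iff]
  intro φ h
  have h1 := isRightIntegral_boson_iff.1 hI (tensorFunctional Coalgebra.counit φ) r h
  -- `N(s) = I(s # h₁) φ(h₂)`, written as the value of the convolution pairing at `s ⊗ 1` so that
  -- linearity in `s` is automatic.
  let N : R →ₗ[k] k :=
    (smashPair I (tensorFunctional Coalgebra.counit φ)).flip (Coalgebra.comul h) ∘ₗ
      (TensorProduct.mk k R R).flip 1
  have hN : ∀ s, N s = pair (BraidedHopf.sliceH I s) φ (Coalgebra.comul h) := by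
    intro s
    simp [N, smashPair_tmul, coactPair_tensor_counit_left,
      BraidedHopfAlgebra.counit_one (k := k) (H := H)]
  have key : ∀ X : R ⊗[k] R, smashPair I (tensorFunctional Coalgebra.counit φ) X
      (Coalgebra.comul h) = pair N (epsMap k 1) X := by
    intro X
    induction X with
    | zero => simp
    | add _ _ h1 h2 => simp only [map_add, LinearMap.add_apply, h1, h2]
    | tmul s t =>
      rw [smashPair_tmul, coactPair_tensor_counit_left, pair_tmul, hN]
      simp [mul_comm]
  rw [key, pair_eps_right, hN, mul_one, one_eq_of] at h1
  simpa [BraidedHopfAlgebra.counit_one (k := k) (H := H)] using h1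

/-- The unwanted factor in `I(r⁽¹⁾ # r⁽²⁾₋₁ h) β(r⁽²⁾₀)` cancels after inserting `S` of a further
coaction of `r⁽²⁾₀`, by `z₁ S(z₂) = ε(z) 1`. -/
theorem IsRightIntegral.sliceR {I : Bosonization k H R →ₗ[k] k} (hI : IsRightIntegral I)
    (h : H) : IsRightIntegral (sliceR I h) := by
  -- `P (s ⊗ t) = I(s # t₋₁ ·) ⊗ t₀`
  let P : R ⊗[k] R →ₗ[k] Module.Dual k H ⊗[k] R :=
    (TensorProduct.curry (I ∘ₗ (Bosonization.of k H R).toLinearMap ∘ₗ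
      (LinearMap.mul' k H).lTensor R ∘ₗ (TensorProduct.assoc k R H H).toLinearMap)).rTensor R ∘ₗ
      (TensorProduct.assoc k R H R).symm.toLinearMap ∘ₗ
      (coact (k := k) (H := H) (V := R)).lTensor R
  -- Testing against all `β ⊗ ε` at all `a` gives an equality of tensors. The tensor form is needed
  -- because `M` below evaluates the functional at a point depending on the leg in `R`.
  have hP : ∀ r, P (Coalgebra.comul r) = BraidedHopf.sliceH I r ⊗ₜ 1 := by
    intro r
    apply dual_tensor_ext
    intro a β
    have h1 := isRightIntegral_boson_iff.1 hI (tensorFunctional β Coalgebra.counit) r a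
    have key : ∀ X : R ⊗[k] R, smashPair I (tensorFunctional β Coalgebra.counit) X
        (Coalgebra.comul a) = pair (LinearMap.applyₗ a) β (P X) := by
      intro X
      induction X with
      | zero => simp
      | add _ _ h1 h2 => simp only [map_add, LinearMap.add_apply, h1, h2]
      | tmul s t =>
        rw [smashPair_tmul, coactPair_tensor_counit_right]
        simp only [P, LinearMap.comp_apply, LinearMap.lTensor_tmul]
        induction coact (k := k) (H := H) t with
        | zero => simp
        | add _ _ h1 h2 => simp only [map_add, TensorProduct.tmul_add, h1, h2]
        | tmul z w => simp
    rw [← key, h1, one_eq_of]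
    simp [mul_comm]
  rw [isRightIntegral_iff]
  intro β r
  -- `M (φ ⊗ w) = φ(S(w₋₁) h) β(w₀)`
  let M : Module.Dual k H ⊗[k] R →ₗ[k] k :=
    pair (V := Module.Dual k H ⊗[k] H) (TensorProduct.lift
        (LinearMap.lcomp k k (LinearMap.mulRight k h ∘ₗ HopfAlgebra.antipode k))) β ∘ₗ
      (TensorProduct.assoc k (Module.Dual k H) H R).symm.toLinearMap ∘ₗ
      (coact (k := k) (H := H) (V := R)).lTensor (Module.Dual k H)
  have hM : ∀ (ψ : Module.Dual k H) (w : R), M (ψ ⊗ₜ w) =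
      pair (ψ ∘ₗ LinearMap.mulRight k h ∘ₗ HopfAlgebra.antipode k) β (coact w) := by
    intro ψ w
    simp only [M, LinearMap.comp_apply, LinearMap.lTensor_tmul]
    induction coact (k := k) (H := H) w with
    | zero => simp
    | add _ _ h1 h2 => simp only [map_add, TensorProduct.tmul_add, h1, h2]
    | tmul z w => simp
  have hMP : ∀ X : R ⊗[k] R, M (P X) = pair (BraidedHopf.sliceR I h) β X := by
    intro X
    induction X with
    | zero => simp
    | add _ _ h1 h2 => simp only [map_add, h1, h2]
    | tmul s t =>
      -- `Φ` sends `z ⊗ (y ⊗ v)` to `I(s # z S(y) h) β(v)`; on the iterated coaction of `t`,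
      -- coassociativity turns `z S(y)` into a counit.
      let Φ : H ⊗[k] (H ⊗[k] R) →ₗ[k] k :=
        pair (BraidedHopf.sliceH I s ∘ₗ LinearMap.mulRight k h ∘ₗ LinearMap.mul' k H ∘ₗ
          (HopfAlgebra.antipode k).lTensor H) β ∘ₗ (TensorProduct.assoc k H H R).symm.toLinearMap
      have e1 : M (P (s ⊗ₜ t)) = Φ ((coact (k := k) (H := H)).lTensor H (coact t)) := by
        simp only [P, LinearMap.comp_apply, LinearMap.lTensor_tmul]
        induction coact (k := k) (H := H) t with
        | zero => simp
        | add _ _ h1 h2 => simp only [map_add, TensorProduct.tmul_add, h1, h2]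
        | tmul z w =>
          simp only [LinearEquiv.coe_coe, TensorProduct.assoc_symm_tmul, LinearMap.rTensor_tmul,
            hM, LinearMap.lTensor_tmul]
          induction coact (k := k) (H := H) w with
          | zero => simp
          | add _ _ h1 h2 => simp only [map_add, TensorProduct.tmul_add, h1, h2]
          | tmul y v => simp [Φ, mul_assoc]
      have e2 := LinearMap.congr_fun
        (YetterDrinfeldModule.coact_coassoc (k := k) (H := H) (V := R)) t
      simp only [LinearMap.comp_apply] at e2
      have e3 : ∀ X : H ⊗[k] R, Φ (TensorProduct.assoc k H H R
          ((Coalgebra.comul (R := k) (A := H)).rTensor R X)) =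
          pair (epsMap k (I (Bosonization.of k H R (s ⊗ₜ h)))) β X := by
        intro X
        induction X with
        | zero => simp
        | add _ _ h1 h2 => simp only [map_add, h1, h2]
        | tmul z w =>
          simp [Φ, HopfAlgebra.mul_antipode_lTensor_comul_apply, Algebra.algebraMap_eq_smul_one]
      rw [e1, ← e2]
      refine (e3 _).trans ?_
      rw [pair_eps_coact]
      simp
  -- Applying `M` to `hP` puts `1` in the leg in `R`, where the coaction and `S(1) = 1` leave `β(1)
  -- I(r # h)`.
  rw [← hMP, hP, hM, coact_one]
  simp [mul_comm]

end right

end bosonization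

/-! ### Left integrals -/

section left

variable {k H R : Type*} [Field k] [Ring H] [HopfAlgebra k H] [Ring R] [Algebra k R]
  [Coalgebra k R] [BraidedHopfAlgebra k H R]

/-- Against `γ ⊗ ε` the factor `r⁽²⁾₋₁ h₁` lies under a counit, so the convolution is `γ(r⁽¹⁾)
I(r⁽²⁾ # h)` with no twist. -/
theorem IsLeftIntegral.sliceR {I : Bosonization k H R →ₗ[k] k} (hI : IsLeftIntegral I)
    (h : H) : IsLeftIntegral (sliceR I h) := by
  rw [isLeftIntegral_iff]
  intro γ r
  have h1 := isLeftIntegral_boson_iff.1 hI (tensorFunctional γ Coalgebra.counit) r h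
  have key : ∀ X : R ⊗[k] R, smashPair (tensorFunctional γ Coalgebra.counit) I X
      (Coalgebra.comul h) = pair γ (BraidedHopf.sliceR I h) X := by
    intro X
    induction X with
    | zero => simp
    | add _ _ h1 h2 => simp only [map_add, LinearMap.add_apply, h1, h2]
    | tmul s t =>
      have : sliceH (tensorFunctional γ Coalgebra.counit : Bosonization k H R →ₗ[k] k) s =
          γ s • Coalgebra.counit := by
        ext; simp
      rw [smashPair_tmul, this, coactPair_smul_left, coactPair_counit]
      simp
  rw [← key, h1, one_eq_of]
  simp

/-- `φ(r₋₁ h₁) I(r₀ # h₂) = φ(1) I(r # h)` for a left integral `I` on `R # H`. -/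
theorem IsLeftIntegral.coactPair_comul {I : Bosonization k H R →ₗ[k] k} (hI : IsLeftIntegral I)
    (φ : H →ₗ[k] k) (r : R) (h : H) : coactPair φ I r (Coalgebra.comul h) =
      φ 1 * I (Bosonization.of k H R (r ⊗ₜ h)) := by
  have h1 := isLeftIntegral_boson_iff.1 hI (tensorFunctional Coalgebra.counit φ) r h
  have key : ∀ X : R ⊗[k] R, smashPair (tensorFunctional Coalgebra.counit φ) I X
      (Coalgebra.comul h) = pair (epsMap k 1) ((coactPair φ I).flip (Coalgebra.comul h)) X := by
    intro X
    induction X with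
    | zero => simp
    | add _ _ h1 h2 => simp only [map_add, LinearMap.add_apply, h1, h2]
    | tmul s t =>
      have : sliceH (tensorFunctional Coalgebra.counit φ : Bosonization k H R →ₗ[k] k) s =
          Coalgebra.counit (R := k) s • φ := by
        ext; simp
      rw [smashPair_tmul, this, coactPair_smul_left]
      simp
  rw [key, pair_eps_left, one_eq_of] at h1
  simpa [BraidedHopfAlgebra.counit_one (k := k) (H := H)] using h1

/-- The functional `r # h ↦ I(r₀ # r₋₁ h)`. -/
def twistFunctional (hS : Function.Bijective (HopfAlgebra.antipode k : H →ₗ[k] H))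
    (I : Bosonization k H R →ₗ[k] k) : Bosonization k H R →ₗ[k] k :=
  I ∘ₗ (Bosonization.of k H R).toLinearMap ∘ₗ (coactEquiv R hS).toLinearMap ∘ₗ
    (Bosonization.of k H R).symm.toLinearMap

@[simp]
theorem twistFunctional_of (hS : Function.Bijective (HopfAlgebra.antipode k : H →ₗ[k] H))
    (I : Bosonization k H R →ₗ[k] k) (x : R ⊗[k] H) :
    twistFunctional hS I (Bosonization.of k H R x) =
      I (Bosonization.of k H R (coactEquiv R hS x)) := rfl

/-- The linear map `r ⊗ h ↦ φ(h₁) I(r # h₂)`. -/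
def comulPair (φ : H →ₗ[k] k) (I : Bosonization k H R →ₗ[k] k) : R ⊗[k] H →ₗ[k] k :=
  pair φ (I ∘ₗ (Bosonization.of k H R).toLinearMap) ∘ₗ
    (TensorProduct.leftComm k R H H).toLinearMap ∘ₗ Coalgebra.comul.lTensor R

theorem comulPair_tmul (φ : H →ₗ[k] k) (I : Bosonization k H R →ₗ[k] k) (r : R) (h : H) :
    comulPair φ I (r ⊗ₜ h) = pair φ (sliceH I r) (Coalgebra.comul h) := by
  simp only [comulPair, LinearMap.comp_apply, LinearMap.lTensor_tmul]
  induction Coalgebra.comul (R := k) h with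
  | zero => simp
  | add _ _ h1 h2 => simp only [map_add, TensorProduct.tmul_add, h1, h2]
  | tmul x y => simp

/-- `φ(r₋₁ h₁) I(r₀₀ # r₀₋₁ h₂) = φ((r₋₁ h)₁) I(r₀ # (r₋₁ h)₂)`. -/
theorem coactPair_twistFunctional
    (hS : Function.Bijective (HopfAlgebra.antipode k : H →ₗ[k] H)) (φ : H →ₗ[k] k)
    (I : Bosonization k H R →ₗ[k] k) (r : R) (h : H) :
    coactPair φ (twistFunctional hS I) r (Coalgebra.comul h) =
      comulPair φ I (coactEquiv R hS (r ⊗ₜ h)) := by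
  -- For `Y = x ⊗ y`, `Ψ Y` sends `z ⊗ (u ⊗ w)` to `φ(z x) I(w # u y)`. By coassociativity `z ⊗ u`
  -- becomes a coproduct `Δ(r₋₁)`, and its product with `Y = Δ(h)` in `H ⊗ H` is `Δ(r₋₁ h)`.
  let Ψ : H ⊗[k] H → (H ⊗[k] (H ⊗[k] R) →ₗ[k] k) := fun Y =>
    pair φ (I ∘ₗ (Bosonization.of k H R).toLinearMap) ∘ₗ
      (TensorProduct.leftComm k R H H).toLinearMap ∘ₗ
      (LinearMap.mulRight k Y).lTensor R ∘ₗ (TensorProduct.comm k (H ⊗[k] H) R).toLinearMap ∘ₗ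
      (TensorProduct.assoc k H H R).symm.toLinearMap
  have hΨ : ∀ Y Y', Ψ (Y + Y') = Ψ Y + Ψ Y' := by
    intro Y Y'
    ext z u w
    simp [Ψ, mul_add, TensorProduct.tmul_add]
  have e1 : ∀ Y, coactPair φ (twistFunctional hS I) r Y =
      Ψ Y ((coact (k := k) (H := H)).lTensor H (coact r)) := by
    intro Y
    induction Y with
    | zero => simp [Ψ]
    | add _ _ h1 h2 => simp only [map_add, hΨ, LinearMap.add_apply, h1, h2]
    | tmul x y =>
      rw [coactPair_tmul]
      induction coact (k := k) (H := H) r with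
      | zero => simp
      | add _ _ h1 h2 => simp only [map_add, h1, h2]
      | tmul z w =>
        simp only [pair_tmul, sliceR_apply, twistFunctional_of, coactEquiv_tmul,
          LinearMap.lTensor_tmul]
        induction coact (k := k) (H := H) w with
        | zero => simp
        | add _ _ h1 h2 => simp only [map_add, mul_add, TensorProduct.tmul_add, h1, h2]
        | tmul u v => simp [Ψ]
  have e2 := LinearMap.congr_fun
    (YetterDrinfeldModule.coact_coassoc (k := k) (H := H) (V := R)) r
  simp only [LinearMap.comp_apply] at e2
  rw [e1, ← e2, coactEquiv_tmul]
  induction coact (k := k) (H := H) r with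
  | zero => simp
  | add _ _ h1 h2 => simp only [map_add, h1, h2]
  | tmul z w =>
    simp [Ψ, comulPair]

/-- For a left integral `I` on `R # H`, the functionals `h ↦ I(r₀ # S⁻¹(r₋₁) h)` are left integrals
on `H`; they are the slices of the functional `J` with `J(r₀ # r₋₁ h) = I(r # h)`. -/
theorem IsLeftIntegral.sliceH_of_twistFunctional
    (hS : Function.Bijective (HopfAlgebra.antipode k : H →ₗ[k] H))
    {J : Bosonization k H R →ₗ[k] k} (hJ : IsLeftIntegral (twistFunctional hS J)) (r : R) :
    IsLeftIntegral (sliceH J r) := by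
  rw [isLeftIntegral_iff]
  intro φ h
  have key : comulPair φ J ∘ₗ (coactEquiv R hS).toLinearMap =
      φ 1 • (J ∘ₗ (Bosonization.of k H R).toLinearMap) ∘ₗ (coactEquiv R hS).toLinearMap := by
    apply TensorProduct.ext'
    intro s a
    simp [← coactPair_twistFunctional, hJ.coactPair_comul]
  -- The identity is known on twisted tensors only; surjectivity of the twist makes it hold at `r ⊗
  -- h`.
  have := LinearMap.congr_fun key ((coactEquiv R hS).symm (r ⊗ₜ h))
  simpa [comulPair_tmul] using this

/-- The twist is invertible, so precomposing with its inverse untwists any functional; thus every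
integral on `R # H` has the form required by `IsLeftIntegral.sliceH_of_twistFunctional`. -/
theorem exists_twistFunctional_eq
    (hS : Function.Bijective (HopfAlgebra.antipode k : H →ₗ[k] H))
    (I : Bosonization k H R →ₗ[k] k) : ∃ J, twistFunctional hS J = I := by
  refine ⟨I ∘ₗ (Bosonization.of k H R).toLinearMap ∘ₗ (coactEquiv R hS).symm.toLinearMap ∘ₗ
    (Bosonization.of k H R).symm.toLinearMap, ?_⟩
  ext x
  simp [twistFunctional]

variable (H) in
/-- The map `r ↦ γ(r₀) r₋₁`. -/
def coactContract (γ : R →ₗ[k] k) : R →ₗ[k] H :=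
  (TensorProduct.rid k H).toLinearMap ∘ₗ γ.lTensor H ∘ₗ coact

/-- `r⁽¹⁾ ⊗ γ(r⁽²⁾₀) r⁽²⁾₋₁ = 1 ⊗ γ(r₀) r₋₁` for a left integral `γ` on `R`. -/
theorem IsLeftIntegral.lTensor_coactContract
    (hS : Function.Bijective (HopfAlgebra.antipode k : H →ₗ[k] H)) {γ : R →ₗ[k] k}
    (hγ : IsLeftIntegral γ) (r : R) :
    (coactContract H γ).lTensor R (Coalgebra.comul r) = 1 ⊗ₜ coactContract H γ r := by
  -- After twisting, the left side is `r⁽¹⁾₀ ⊗ r⁽¹⁾₋₁ r⁽²⁾₋₁ γ(r⁽²⁾₀)`. Colinearity of the coproduct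
  -- rewrites it as `γ` applied to the second leg of `Δ(r₀)`, with `r₋₁` outside, and the integral
  -- property replaces the first leg by `1`.
  apply (coactEquiv R hS).injective
  have h1 := coact_pair_comul (k := k) (H := H) (R := R)
    (Algebra.TensorProduct.includeRight : H →ₐ[k] R ⊗[k] H)
    (Algebra.TensorProduct.includeLeft : R →ₐ[k] R ⊗[k] H).toLinearMap
    (LinearMap.toSpanSingleton k (R ⊗[k] H) 1 ∘ₗ γ) (fun x r => by simp [Commute, SemiconjBy]) r
  have h2 : pair (Algebra.TensorProduct.includeLeft : R →ₐ[k] R ⊗[k] H).toLinearMap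
      (LinearMap.toSpanSingleton k (R ⊗[k] H) 1 ∘ₗ γ) ∘ₗ Coalgebra.comul =
      LinearMap.toSpanSingleton k (R ⊗[k] H) 1 ∘ₗ γ := by
    ext s
    rw [LinearMap.comp_apply, hγ.pair_toSpanSingleton]
    simp [Algebra.TensorProduct.one_def]
  have h3 : ∀ s : R, pair (Algebra.TensorProduct.includeRight : H →ₐ[k] R ⊗[k] H).toLinearMap
      (LinearMap.toSpanSingleton k (R ⊗[k] H) 1 ∘ₗ γ) (coact s) = 1 ⊗ₜ coactContract H γ s := by
    intro s
    simp only [coactContract, LinearMap.comp_apply]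
    induction coact (k := k) (H := H) s with
    | zero => simp
    | add _ _ h1 h2 => simp only [map_add, TensorProduct.tmul_add, h1, h2]
    | tmul z w => simp
  rw [h2, h3] at h1
  -- The twist fixes `1 ⊗ H`, since the coaction of `1` is trivial.
  have h4 : coactEquiv R hS (1 ⊗ₜ coactContract H γ r) = 1 ⊗ₜ coactContract H γ r := by
    simp [coactEquiv_tmul, coact_one]
  rw [h4, h1]
  induction Coalgebra.comul (R := k) r with
  | zero => simp
  | add _ _ h1 h2 => simp only [map_add, h1, h2]
  | tmul s t =>
    rw [pair_tmul, LinearMap.comp_apply, LinearMap.comp_apply, h3, LinearMap.lTensor_tmul,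
      coactEquiv_tmul]
    induction coact (k := k) (H := H) s with
    | zero => simp
    | add _ _ h1 h2 => simp only [map_add, add_mul, h1, h2]
    | tmul z w => simp

/-- Write `I` for the twisted functional. The integral property of `φ` reduces the convolution with
`α` to `α(r⁽¹⁾ # 1) I(r⁽²⁾ # h)`. Since `I(t # h)` depends on `t` only through `γ(t₀) t₋₁`,
`IsLeftIntegral.lTensor_coactContract` replaces `r⁽¹⁾` by `1` and `r⁽²⁾` by `r`. -/
theorem isLeftIntegral_twistFunctional
    (hS : Function.Bijective (HopfAlgebra.antipode k : H →ₗ[k] H)) {γ : R →ₗ[k] k}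
    {φ : H →ₗ[k] k} (hγ : IsLeftIntegral γ) (hφ : IsLeftIntegral φ) :
    IsLeftIntegral (twistFunctional hS (tensorFunctional γ φ : Bosonization k H R →ₗ[k] k)) := by
  rw [isLeftIntegral_boson_iff]
  intro α r h
  have h1 : ∀ f : H →ₗ[k] k, comulPair f (tensorFunctional γ φ : Bosonization k H R →ₗ[k] k) =
      f 1 • pair γ φ := by
    intro f
    apply TensorProduct.ext'
    intro w g
    have : sliceH (tensorFunctional γ φ : Bosonization k H R →ₗ[k] k) w = γ w • φ := by
      ext; simp
    have h2 : ∀ X : H ⊗[k] H, pair f (γ w • φ) X = γ w * pair f φ X := by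
      intro X
      induction X with
      | zero => simp
      | add _ _ h1 h2 => simp only [map_add, mul_add, h1, h2]
      | tmul x y => simp; ring
    rw [comulPair_tmul, this, h2, isLeftIntegral_iff.1 hφ]
    simp
    ring
  have h2 : sliceR (twistFunctional hS (tensorFunctional γ φ : Bosonization k H R →ₗ[k] k)) h =
      (φ ∘ₗ LinearMap.mulRight k h) ∘ₗ coactContract H γ := by
    ext t
    simp only [sliceR_apply, twistFunctional_of, tensorFunctional_of, coactEquiv_tmul,
      coactContract, LinearMap.comp_apply]
    induction coact (k := k) (H := H) t with
    | zero => simp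
    | add _ _ h1 h2 => simp only [map_add, h1, h2]
    | tmul z w => simp
  have key : ∀ X : R ⊗[k] R, smashPair α (twistFunctional hS (tensorFunctional γ φ)) X
      (Coalgebra.comul h) = pair (sliceR α 1)
        (sliceR (twistFunctional hS (tensorFunctional γ φ)) h) X := by
    intro X
    induction X with
    | zero => simp
    | add _ _ h1 h2 => simp only [map_add, LinearMap.add_apply, h1, h2]
    | tmul s t =>
      rw [smashPair_tmul, coactPair_twistFunctional, h1]
      simp
  rw [key, ← sliceR_apply, h2, ← pair_lTensor, hγ.lTensor_coactContract hS]
  simp [one_eq_of]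

end left

end BraidedHopf
end

/-! ### The two equivalences -/

theorem mainTheorem3 {k : Type*} {H : Type*} {R : Type*} [Field k]
    [Ring H] [HopfAlgebra k H]
    (hS : Function.Bijective (HopfAlgebra.antipode k : H →ₗ[k] H))
    [Ring R] [Algebra k R] [Coalgebra k R] [BraidedHopf.BraidedHopfAlgebra k H R] :
    (BraidedHopf.IsLeftCoFrobenius k (BraidedHopf.Bosonization k H R) ↔
      BraidedHopf.IsLeftCoFrobenius k H ∧ BraidedHopf.IsLeftCoFrobenius k R) ∧
    (BraidedHopf.IsRightCoFrobenius k (BraidedHopf.Bosonization k H R) ↔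
      BraidedHopf.IsRightCoFrobenius k H ∧ BraidedHopf.IsRightCoFrobenius k R) := by
  refine ⟨⟨?_, ?_⟩, ⟨?_, ?_⟩⟩
  · rintro ⟨I, hne, hI⟩
    obtain ⟨r, h, hrh⟩ := BraidedHopf.exists_of_tmul_ne_zero hne
    obtain ⟨J, rfl⟩ := BraidedHopf.exists_twistFunctional_eq hS I
    have hJ : J ≠ 0 := by
      rintro rfl
      exact hrh rfl
    obtain ⟨s, a, hsa⟩ := BraidedHopf.exists_of_tmul_ne_zero hJ
    -- The slice in `H` is taken from the untwisted `J` and the slice in `R` from the integral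
    -- itself, so each needs its own pure tensor with nonzero value.
    exact ⟨⟨_, fun h0 => hsa (LinearMap.congr_fun h0 a), hI.sliceH_of_twistFunctional hS s⟩,
      ⟨_, fun h0 => hrh (LinearMap.congr_fun h0 r), hI.sliceR h⟩⟩
  · rintro ⟨⟨φ, hφ0, hφ⟩, ⟨γ, hγ0, hγ⟩⟩
    obtain ⟨h, hh⟩ := DFunLike.ne_iff.1 hφ0
    obtain ⟨r, hr⟩ := DFunLike.ne_iff.1 hγ0
    refine ⟨_, fun h0 => ?_, BraidedHopf.isLeftIntegral_twistFunctional hS hγ hφ⟩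
    -- At the preimage of `r ⊗ h` under the twist, the functional takes the value `γ(r) φ(h)`, which
    -- is nonzero.
    have := LinearMap.congr_fun h0 (BraidedHopf.Bosonization.of k H R
      ((BraidedHopf.coactEquiv R hS).symm (r ⊗ₜ h)))
    rw [BraidedHopf.twistFunctional_of, LinearEquiv.apply_symm_apply] at this
    exact mul_ne_zero hr hh this
  · rintro ⟨I, hne, hI⟩
    obtain ⟨r, h, hrh⟩ := BraidedHopf.exists_of_tmul_ne_zero hne
    exact ⟨⟨_, fun h0 => hrh (LinearMap.congr_fun h0 h), hI.sliceH r⟩,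
      ⟨_, fun h0 => hrh (LinearMap.congr_fun h0 r), hI.sliceR h⟩⟩
  · rintro ⟨⟨φ, hφ0, hφ⟩, ⟨γ, hγ0, hγ⟩⟩
    obtain ⟨h, hh⟩ := DFunLike.ne_iff.1 hφ0
    obtain ⟨r, hr⟩ := DFunLike.ne_iff.1 hγ0
    refine ⟨_, fun h0 => ?_, BraidedHopf.isRightIntegral_tensorFunctional hγ hφ⟩
    exact mul_ne_zero hr hh
      (LinearMap.congr_fun h0 (BraidedHopf.Bosonization.of k H R (r ⊗ₜ h)))
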